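/- Let $R$ be an associative unital ring. Modules are left $R$-modules unless stated otherwise. A module is Gorenstein flat if it is a syzygy (the image of a differential) of an acyclic complex $F_*$, unbounded in both directions, of flat modules such that $I\otimes_R F_*$ is acyclic for every injective right $R$-module $I$. A module is a PGF-module (projectively coresolved Gorenstein flat) if it is a syzygy of such a complex all of whose terms are projective. The PGF-dimension $\mathrm{PGF\text{-}dim}_R M\in\{0,1,2,\dots\}\cup\{\infty\}$ of a module $M$ is the least $n\ge 0$ for which there is an exact sequence $$0\to G_n\to\cdots\to G_1\to G_0\to M\to 0$$ with all $G_i$ PGF-modules, and $\infty$ if there is no such $n$. Let $\mathrm{pd}_R M$ be the projective dimension of $M$, with the convention $\mathrm{pd}_R 0=0$, and let $\mathrm{splf}\,R$ be the supremum of $\mathrm{pd}_R M$ over all flat modules $M$. Then $$\sup\{\mathrm{PGF\text{-}dim}_R M : M \text{ a Gorenstein flat module}\}=\mathrm{splf}\,R .$$ In particular, every flat module has finite projective dimension if and only if every Gorenstein flat module has finite PGF-dimension. -/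

import Mathlib

universe u

open scoped TensorProduct

namespace PGF

noncomputable section

/-! ### The tensor product over a noncommutative ring

Left `R`-modules are modules over `R`, right `R`-modules are modules over `Rᵐᵒᵖ`. -/

section Tensor

variable (R : Type u) [Ring R]

/-- The subgroup of `A ⊗[ℤ] M` generated by the elements `(a r) ⊗ m - a ⊗ (r m)`. -/
def balancedRel (A M : Type u) [AddCommGroup A] [Module Rᵐᵒᵖ A] [AddCommGroup M] [Module R M] :
    AddSubgroup (A ⊗[ℤ] M) :=
  AddSubgroup.closure
    {x | ∃ (a : A) (r : R) (m : M), x = (MulOpposite.op r • a) ⊗ₜ[ℤ] m - a ⊗ₜ[ℤ] (r • m)}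

/-- The abelian group `A ⊗_R M`, for a right `R`-module `A` and a left `R`-module `M`. -/
abbrev Tensor (A M : Type u) [AddCommGroup A] [Module Rᵐᵒᵖ A] [AddCommGroup M] [Module R M] :
    Type u :=
  (A ⊗[ℤ] M) ⧸ balancedRel R A M

variable {R}

/-- The map `A ⊗_R f : A ⊗_R M → A ⊗_R N` induced by a map `f : M → N` of left modules. -/
def tensorLeft (A : Type u) [AddCommGroup A] [Module Rᵐᵒᵖ A]
    {M N : Type u} [AddCommGroup M] [Module R M] [AddCommGroup N] [Module R N] (f : M →ₗ[R] N) :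
    Tensor R A M →+ Tensor R A N :=
  QuotientAddGroup.map (balancedRel R A M) (balancedRel R A N)
    (LinearMap.lTensor A f.toAddMonoidHom.toIntLinearMap).toAddMonoidHom <| by
      rw [balancedRel, AddSubgroup.closure_le]
      rintro _ ⟨a, r, m, rfl⟩
      exact AddSubgroup.subset_closure ⟨a, r, f m, by simp⟩

/-- The map `g ⊗_R M : A ⊗_R M → B ⊗_R M` induced by a map `g : A → B` of right modules. -/
def tensorRight {A B : Type u} [AddCommGroup A] [Module Rᵐᵒᵖ A] [AddCommGroup B] [Module Rᵐᵒᵖ B]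
    (M : Type u) [AddCommGroup M] [Module R M] (g : A →ₗ[Rᵐᵒᵖ] B) :
    Tensor R A M →+ Tensor R B M :=
  QuotientAddGroup.map (balancedRel R A M) (balancedRel R B M)
    (LinearMap.rTensor M g.toAddMonoidHom.toIntLinearMap).toAddMonoidHom <| by
      rw [balancedRel, AddSubgroup.closure_le]
      rintro _ ⟨a, r, m, rfl⟩
      exact AddSubgroup.subset_closure ⟨g a, r, m, by simp⟩

end Tensor

/-! ### Flat, Gorenstein flat and PGF modules -/

section Modules

variable (R : Type u) [Ring R]

/-- A left `R`-module `M` is flat if `_ ⊗_R M` preserves injections of right modules. -/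
def IsFlat (M : Type u) [AddCommGroup M] [Module R M] : Prop :=
  ∀ (A B : Type u) [AddCommGroup A] [Module Rᵐᵒᵖ A] [AddCommGroup B] [Module Rᵐᵒᵖ B]
    (g : A →ₗ[Rᵐᵒᵖ] B), Function.Injective g → Function.Injective (tensorRight M g)

/-- An acyclic complex `⋯ → X₂ → X₁ → X₀ → X₋₁ → ⋯` of left `R`-modules. -/
structure AcyclicComplex where
  /-- the terms of the complex -/
  X : ℤ → ModuleCat.{u} R
  /-- the differentials -/
  d : ∀ i : ℤ, X (i + 1) →ₗ[R] X i
  exact : ∀ i : ℤ, Function.Exact (d (i + 1)) (d i)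

variable {R}

/-- The complex `I ⊗_R X` is acyclic for any injective right module `I`. -/
def AcyclicComplex.TensorInjectiveAcyclic (C : AcyclicComplex R) : Prop :=
  ∀ (I : Type u) [AddCommGroup I] [Module Rᵐᵒᵖ I], Module.Injective Rᵐᵒᵖ I →
    ∀ i : ℤ, Function.Exact (tensorLeft I (C.d (i + 1))) (tensorLeft I (C.d i))

/-- `M` is (isomorphic to) one of the syzygies of the complex. -/
def AcyclicComplex.HasSyzygy (C : AcyclicComplex R)
    (M : Type u) [AddCommGroup M] [Module R M] : Prop :=
  ∃ i : ℤ, Nonempty (M ≃ₗ[R] LinearMap.range (C.d i))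

variable (R)

/-- Gorenstein flat modules: the syzygies of the acyclic complexes of flat modules that remain
acyclic under `I ⊗_R _` for any injective right module `I`. -/
def IsGorensteinFlat (M : Type u) [AddCommGroup M] [Module R M] : Prop :=
  ∃ C : AcyclicComplex R,
    (∀ i, IsFlat R (C.X i)) ∧ C.TensorInjectiveAcyclic ∧ C.HasSyzygy M

/-- Projectively coresolved Gorenstein flat modules: the syzygies of the acyclic complexes of
projective modules that remain acyclic under `I ⊗_R _` for any injective right module `I`. -/
def IsPGF (M : Type u) [AddCommGroup M] [Module R M] : Prop :=
  ∃ C : AcyclicComplex R,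
    (∀ i, Module.Projective R (C.X i)) ∧ C.TensorInjectiveAcyclic ∧ C.HasSyzygy M

/-! ### Dimensions -/

/-- There is an exact sequence `0 → G n → ⋯ → G 1 → G 0 → M → 0` with all `G i` PGF-modules
(the sequence is continued by zero modules in degrees `> n`). -/
def HasPGFResolution (M : Type u) [AddCommGroup M] [Module R M] (n : ℕ) : Prop :=
  ∃ (G : ℕ → ModuleCat.{u} R) (ε : G 0 →ₗ[R] M) (d : ∀ i : ℕ, G (i + 1) →ₗ[R] G i),
    (∀ i ≤ n, IsPGF R (G i)) ∧ (∀ i, n < i → Subsingleton (G i)) ∧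
    Function.Surjective ε ∧ Function.Exact (d 0) ε ∧
    ∀ i, Function.Exact (d (i + 1)) (d i)

/-- The PGF-dimension: the least length of a PGF-resolution, `⊤` if there is none of finite
length. -/
def pgfDim (M : Type u) [AddCommGroup M] [Module R M] : ℕ∞ :=
  ⨅ (n : ℕ) (_ : HasPGFResolution R M n), (n : ℕ∞)

/-- The projective dimension with values in `ℕ∞`, where the zero module has dimension `0`
(Mathlib's `projectiveDimension` takes the value `⊥` there). -/
def pd (M : Type u) [AddCommGroup M] [Module R M] : ℕ∞ :=
  (CategoryTheory.projectiveDimension (ModuleCat.of R M)).unbotD 0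

/-- `splf R`: the supremum of the projective dimensions of the flat left `R`-modules. -/
def splf : ℕ∞ :=
  sSup {d : ℕ∞ | ∃ M : ModuleCat.{u} R, IsFlat R M ∧ pd R M = d}

end Modules

end

end PGF

/-!
The heart of the matter is that `Ext^j(G, F) = 0` for `G` a PGF-module, `F` a flat module and
`j > 0`, i.e. that a complex of projective modules which is acyclic under `I ⊗_R _` for all
injective right modules `I` is also acyclic under `Hom(_, F)` for all flat `F`.

Summing up the terms and adding a contractible complex, one may assume that the complex is periodic
and free, and so is given by a square-zero row-finite matrix `f`; one has to solve `f w = h` for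
column vectors with entries in `F` when `f h = 0`. As products of injective modules are injective,
exactness over injectives is uniform: cycles supported on a finite set `T` of indices bound chains
supported on a finite set `S(T)` (`IsGood.exists_finset`). The character module `F⁺` is injective,
so by duality a column vector which is a cycle on `S(T)` is a boundary on `T`
(`Bounds.exists_colMap_eq`). This is a Mittag-Leffler condition which gives solutions on countable
sets of indices, modulo sets on which the equation has been solved already
(`IsGood.exists_extension`); Zorn's lemma does the rest (`IsInjExact.exists_colMap_eq`).

By dimension shifting, a module `M` with a PGF-resolution of length `n` has `Ext^j(M, F) = 0` for
`F` flat and `j > n`. If `M` itself is flat then so are its syzygies, and therefore `pd M ≤ n`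
(`pd_le_pgfDim`). Since flat modules are Gorenstein flat, this yields one inequality.

For the other one let `M` be a syzygy of a complex `C` of flat modules as in the definition of
Gorenstein flat modules, and suppose that flat modules have projective dimension at most `n`. Map a
contractible complex of free modules onto `C`. The kernel is a complex of the same kind, with terms
of smaller projective dimension (`AcyclicComplex.TensorInjectiveAcyclic.coverKer`), and its syzygies
are first syzygies of those of `C`. After `n` steps the terms are projective and the syzygies are
PGF-modules (`AcyclicComplex.hasPGFResolution_range`).

The finiteness statement follows, as a direct sum of flat modules of unbounded projective dimension
would be a flat module of infinite projective dimension (`splf_lt_top`).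
-/

namespace PGF

noncomputable section

/-! ### Tensor products and character modules -/

section TensorBasics

variable {R : Type u} [Ring R]
variable {A B : Type u} [AddCommGroup A] [Module Rᵐᵒᵖ A] [AddCommGroup B] [Module Rᵐᵒᵖ B]
variable {M N L : Type u} [AddCommGroup M] [Module R M] [AddCommGroup N] [Module R N]
  [AddCommGroup L] [Module R L]

variable (R) in
/-- The class of `a ⊗ m` in `A ⊗_R M`. -/
def tmk (a : A) (m : M) : Tensor R A M := QuotientAddGroup.mk (a ⊗ₜ[ℤ] m)

lemma tmk_add_left (a a' : A) (m : M) : tmk R (a + a') m = tmk R a m + tmk R a' m := by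
  simp [tmk, TensorProduct.add_tmul]

lemma tmk_add_right (a : A) (m m' : M) : tmk R a (m + m') = tmk R a m + tmk R a m' := by
  simp [tmk, TensorProduct.tmul_add]

lemma tmk_smul (a : A) (r : R) (m : M) : tmk R (MulOpposite.op r • a) m = tmk R a (r • m) :=
  (QuotientAddGroup.eq_iff_sub_mem).2 (AddSubgroup.subset_closure ⟨a, r, m, rfl⟩)

/-- `tmk` as a bundled biadditive map. -/
def tmkHom : A →+ M →+ Tensor R A M :=
  AddMonoidHom.mk' (fun a => AddMonoidHom.mk' (fun m => tmk R a m) (tmk_add_right a))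
    fun a a' => by ext m; exact tmk_add_left a a' m

@[simp] lemma tmkHom_apply (a : A) (m : M) : tmkHom (R := R) a m = tmk R a m := rfl

@[simp] lemma tensorLeft_tmk (f : M →ₗ[R] N) (a : A) (m : M) :
    tensorLeft A f (tmk R a m) = tmk R a (f m) := rfl

@[simp] lemma tensorRight_tmk (g : A →ₗ[Rᵐᵒᵖ] B) (a : A) (m : M) :
    tensorRight M g (tmk R a m) = tmk R (g a) m := rfl

@[elab_as_elim]
lemma tensor_induction {p : Tensor R A M → Prop} (z : Tensor R A M)
    (tmul : ∀ a m, p (tmk R a m)) (add : ∀ x y, p x → p y → p (x + y)) : p z := by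
  obtain ⟨z, rfl⟩ := QuotientAddGroup.mk_surjective z
  induction z using TensorProduct.induction_on with
  | zero => simpa [tmk] using tmul 0 0
  | tmul a m => exact tmul a m
  | add x y hx hy => exact add _ _ hx hy

lemma tensor_hom_ext {G : Type*} [AddCommGroup G] {f g : Tensor R A M →+ G}
    (h : ∀ a m, f (tmk R a m) = g (tmk R a m)) : f = g := by
  refine AddMonoidHom.ext fun z => ?_
  induction z using tensor_induction with
  | tmul a m => exact h a m
  | add x y hx hy => rw [map_add, map_add, hx, hy]

/-- The universal property of `A ⊗_R M`: a balanced biadditive map induces an additive map. -/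
def tensorLift {G : Type*} [AddCommGroup G] (φ : A →+ M →+ G)
    (h : ∀ a (r : R) m, φ (MulOpposite.op r • a) m = φ a (r • m)) : Tensor R A M →+ G :=
  QuotientAddGroup.lift (balancedRel R A M)
    (TensorProduct.liftAddHom φ fun n a m => by simp) <| by
      rw [balancedRel, AddSubgroup.closure_le]
      rintro _ ⟨a, r, m, rfl⟩
      simp [h]

lemma tensorLeft_id : tensorLeft A (LinearMap.id : M →ₗ[R] M) = AddMonoidHom.id _ :=
  tensor_hom_ext fun _ _ => rfl

lemma tensorLeft_comp (g : N →ₗ[R] L) (f : M →ₗ[R] N) :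
    tensorLeft A (g ∘ₗ f) = (tensorLeft A g).comp (tensorLeft A f) :=
  tensor_hom_ext fun _ _ => rfl

lemma tensorLeft_comp_apply (g : N →ₗ[R] L) (f : M →ₗ[R] N) (z : Tensor R A M) :
    tensorLeft A (g ∘ₗ f) z = tensorLeft A g (tensorLeft A f z) := by
  rw [tensorLeft_comp]; rfl

lemma tensorLeft_zero : tensorLeft A (0 : M →ₗ[R] N) = 0 :=
  tensor_hom_ext fun a m => by
    rw [tensorLeft_tmk]; exact map_zero (tmkHom (R := R) (M := N) a)

lemma tensorLeft_add (f g : M →ₗ[R] N) : tensorLeft A (f + g) = tensorLeft A f + tensorLeft A g :=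
  tensor_hom_ext fun a m => tmk_add_right a (f m) (g m)

lemma tensorRight_comp_tensorLeft (g : A →ₗ[Rᵐᵒᵖ] B) (f : M →ₗ[R] N) (z : Tensor R A M) :
    tensorRight N g (tensorLeft A f z) = tensorLeft B f (tensorRight M g z) :=
  DFunLike.congr_fun (tensor_hom_ext (f := (tensorRight N g).comp (tensorLeft A f))
    (g := (tensorLeft B f).comp (tensorRight M g)) fun _ _ => rfl) z

lemma tensorLeft_surjective (f : M →ₗ[R] N) (hf : Function.Surjective f) :
    Function.Surjective (tensorLeft A f) := by
  intro z
  induction z using tensor_induction with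
  | tmul a n =>
    obtain ⟨m, rfl⟩ := hf n
    exact ⟨tmk R a m, rfl⟩
  | add x y hx hy =>
    obtain ⟨x, rfl⟩ := hx
    obtain ⟨y, rfl⟩ := hy
    exact ⟨x + y, map_add _ _ _⟩

end TensorBasics

section Characters

variable {R : Type u} [Ring R]
variable {A B : Type u} [AddCommGroup A] [Module Rᵐᵒᵖ A] [AddCommGroup B] [Module Rᵐᵒᵖ B]
variable {M N L : Type u} [AddCommGroup M] [Module R M] [AddCommGroup N] [Module R N]
  [AddCommGroup L] [Module R L]

/-- Characters with values in `ℚ / ℤ` separate the points outside of a subgroup. -/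
lemma exists_character_of_notMem {G : Type u} [AddCommGroup G] (H : AddSubgroup G) {x : G}
    (hx : x ∉ H) : ∃ χ : G →+ AddCircle (1 : ℚ), (∀ y ∈ H, χ y = 0) ∧ χ x ≠ 0 := by
  have hx' : (QuotientAddGroup.mk x : G ⧸ H) ≠ 0 := by
    rwa [Ne, QuotientAddGroup.eq_zero_iff]
  obtain ⟨c, hc⟩ := CharacterModule.exists_character_apply_ne_zero_of_ne_zero hx'
  let c' : G ⧸ H →+ AddCircle (1 : ℚ) := c
  refine ⟨c'.comp (QuotientAddGroup.mk' H), fun y hy => ?_, hc⟩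
  have : (QuotientAddGroup.mk' H) y = 0 := (QuotientAddGroup.eq_zero_iff y).2 hy
  rw [AddMonoidHom.comp_apply, this, map_zero]

/-- The character module `Hom_ℤ(M, ℚ / ℤ)` of a left `R`-module `M`, a right `R`-module by
`(χ r) m = χ (r m)`. Unlike Mathlib's `CharacterModule`, it is for noncommutative rings. -/
def RightDual (M : Type u) [AddCommGroup M] : Type u := M →+ AddCircle (1 : ℚ)

instance (M : Type u) [AddCommGroup M] : AddCommGroup (RightDual M) :=
  inferInstanceAs (AddCommGroup (M →+ AddCircle (1 : ℚ)))

instance (M : Type u) [AddCommGroup M] : FunLike (RightDual M) M (AddCircle (1 : ℚ)) :=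
  inferInstanceAs (FunLike (M →+ AddCircle (1 : ℚ)) M (AddCircle (1 : ℚ)))

instance (M : Type u) [AddCommGroup M] :
    AddMonoidHomClass (RightDual M) M (AddCircle (1 : ℚ)) :=
  inferInstanceAs (AddMonoidHomClass (M →+ AddCircle (1 : ℚ)) M (AddCircle (1 : ℚ)))

@[ext] lemma RightDual.ext {χ χ' : RightDual M} (h : ∀ m, χ m = χ' m) : χ = χ' :=
  DFunLike.ext _ _ h

instance : Module Rᵐᵒᵖ (RightDual M) where
  smul r χ := AddMonoidHom.comp (show M →+ AddCircle (1 : ℚ) from χ)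
    (DistribSMul.toAddMonoidHom M r.unop)
  one_smul χ := RightDual.ext fun m => congrArg χ (one_smul R m)
  mul_smul r s χ := RightDual.ext fun m => congrArg χ (mul_smul s.unop r.unop m)
  smul_zero _ := rfl
  smul_add _ _ _ := rfl
  add_smul r s χ := RightDual.ext fun m =>
    (congrArg χ (add_smul r.unop s.unop m)).trans (map_add χ _ _)
  zero_smul χ := RightDual.ext fun m => (congrArg χ (zero_smul R m)).trans (map_zero χ)

@[simp] lemma RightDual.zero_apply (m : M) : (0 : RightDual M) m = 0 := rfl

/-- Precomposition with a map of left modules, as a map of right modules. -/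
def RightDual.map (f : M →ₗ[R] N) : RightDual N →ₗ[Rᵐᵒᵖ] RightDual M where
  toFun χ := AddMonoidHom.comp (show N →+ AddCircle (1 : ℚ) from χ) f.toAddMonoidHom
  map_add' _ _ := rfl
  map_smul' r χ := RightDual.ext fun m => congrArg χ (f.map_smul r.unop m).symm

lemma RightDual.map_surjective (f : M →ₗ[R] N) (hf : Function.Injective f) :
    Function.Surjective (RightDual.map f) := fun χ =>
  CharacterModule.dual_surjective_of_injective
    f.toAddMonoidHom.toIntLinearMap hf χ

lemma RightDual.map_injective (f : M →ₗ[R] N) (hf : Function.Surjective f) :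
    Function.Injective (RightDual.map f) := fun χ χ' h =>
  RightDual.ext fun n => by
    obtain ⟨m, rfl⟩ := hf n
    exact DFunLike.congr_fun h m

lemma RightDual.map_exact (f : M →ₗ[R] N) (g : N →ₗ[R] L) (h : Function.Exact f g)
    (hg : Function.Surjective g) :
    Function.Exact (RightDual.map g) (RightDual.map f) := by
  intro χ
  constructor
  · intro hχ
    have hle : g.toAddMonoidHom.ker ≤ AddMonoidHom.ker (show N →+ AddCircle (1 : ℚ) from χ) := by
      intro n hn
      obtain ⟨m, rfl⟩ := (h n).1 hn
      exact DFunLike.congr_fun hχ m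
    refine ⟨(g.toAddMonoidHom.liftOfSurjective hg)
      ⟨(show N →+ AddCircle (1 : ℚ) from χ), hle⟩, RightDual.ext fun n => ?_⟩
    exact AddMonoidHom.liftOfRightInverse_comp_apply g.toAddMonoidHom _
      (Function.rightInverse_surjInv hg)
      ⟨(show N →+ AddCircle (1 : ℚ) from χ), hle⟩ n
  · rintro ⟨ψ, rfl⟩
    exact RightDual.ext fun m => (congrArg ψ (h.apply_apply_eq_zero m)).trans (map_zero ψ)

/-- A map `A → M⁺` of right modules, seen as a character of `A ⊗_R M`. -/
def uncurryDual (φ : A →ₗ[Rᵐᵒᵖ] RightDual M) : Tensor R A M →+ AddCircle (1 : ℚ) :=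
  tensorLift (G := AddCircle (1 : ℚ))
    (AddMonoidHom.mk' (fun a => (show M →+ AddCircle (1 : ℚ) from φ a)) fun a a' => φ.map_add a a')
    fun a r m => DFunLike.congr_fun (φ.map_smul (MulOpposite.op r) a) m

/-- A character of `A ⊗_R M`, seen as a map `A → M⁺` of right modules. -/
def curryDual (θ : Tensor R A M →+ AddCircle (1 : ℚ)) : A →ₗ[Rᵐᵒᵖ] RightDual M where
  toFun a := θ.comp (tmkHom a)
  map_add' a a' := RightDual.ext fun m =>
    (congrArg θ (tmk_add_left a a' m)).trans (map_add θ _ _)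
  map_smul' r a := RightDual.ext fun m => congrArg θ (tmk_smul a r.unop m)

/-- Lambek's theorem: the character module of a flat module is injective. -/
lemma IsFlat.injective_rightDual (hM : IsFlat R M) : Module.Injective Rᵐᵒᵖ (RightDual M) where
  out A B _ _ _ _ g hg φ := by
    obtain ⟨θ, hθ⟩ := CharacterModule.dual_surjective_of_injective
      (tensorRight M g).toIntLinearMap (hM A B g hg) (uncurryDual φ)
    refine ⟨curryDual θ, fun a => RightDual.ext fun m => ?_⟩
    exact DFunLike.congr_fun hθ (tmk R a m)

/-- A short exact sequence whose last term is flat is pure: since `C⁺` is injective,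
`0 → C⁺ → P⁺ → K⁺ → 0` splits, and so every map `A → K⁺` lifts to `P⁺`. -/
lemma IsFlat.tensorLeft_injective {f : M →ₗ[R] N} {g : N →ₗ[R] L} (hL : IsFlat R L)
    (hf : Function.Injective f) (hfg : Function.Exact f g) (hg : Function.Surjective g) :
    Function.Injective (tensorLeft A f) := by
  obtain ⟨l, hl⟩ := hL.injective_rightDual.out (RightDual.map g) (RightDual.map_injective g hg)
    LinearMap.id
  have tfae := (RightDual.map_exact f g hfg hg).split_tfae (RightDual.map_injective g hg)
    (RightDual.map_surjective f hf)
  obtain ⟨s, hs⟩ : ∃ s, RightDual.map f ∘ₗ s = LinearMap.id :=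
    (tfae.out 0 1 rfl rfl).2 ⟨l, LinearMap.ext hl⟩
  rw [injective_iff_map_eq_zero]
  intro z hz
  by_contra hne
  obtain ⟨θ, -, hθ⟩ := exists_character_of_notMem (⊥ : AddSubgroup (Tensor R A M)) (x := z)
    (by simpa using hne)
  have key : (uncurryDual (s ∘ₗ curryDual θ)).comp (tensorLeft A f) = θ :=
    tensor_hom_ext fun a m => DFunLike.congr_fun (LinearMap.congr_fun hs (curryDual θ a)) m
  apply hθ
  rw [← key, AddMonoidHom.comp_apply, hz, map_zero]

/-- The tensor product is right exact. -/
lemma tensorLeft_exact {f : M →ₗ[R] N} {g : N →ₗ[R] L}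
    (hfg : Function.Exact f g) (hg : Function.Surjective g) :
    Function.Exact (tensorLeft A f) (tensorLeft A g) := by
  intro z
  constructor
  · intro hz
    by_contra hne
    obtain ⟨θ, hθ, hθz⟩ := exists_character_of_notMem (tensorLeft A f).range (x := z) hne
    have h0 : ∀ a, RightDual.map f (curryDual θ a) = 0 := fun a =>
      RightDual.ext fun m => hθ _ ⟨tmk R a m, rfl⟩
    choose ψ hψ using fun a => (RightDual.map_exact f g hfg hg _).1 (h0 a)
    have hinj := RightDual.map_injective g hg
    let φ : A →ₗ[Rᵐᵒᵖ] RightDual L :=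
      { toFun := ψ
        map_add' := fun a a' => hinj (by simp [hψ])
        map_smul' := fun r a => hinj (by simp [hψ]) }
    have key : (uncurryDual φ).comp (tensorLeft A g) = θ :=
      tensor_hom_ext fun a m => DFunLike.congr_fun (hψ a) m
    apply hθz
    rw [← key, AddMonoidHom.comp_apply, hz, map_zero]
  · rintro ⟨z, rfl⟩
    rw [← tensorLeft_comp_apply, hfg.linearMap_comp_eq_zero, tensorLeft_zero]
    rfl

/-- The kernel of a surjection between flat modules is flat. -/
lemma IsFlat.of_exact {f : M →ₗ[R] N} {g : N →ₗ[R] L} (hN : IsFlat R N) (hL : IsFlat R L)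
    (hf : Function.Injective f) (hfg : Function.Exact f g) (hg : Function.Surjective g) :
    IsFlat R M := by
  intro A B _ _ _ _ j hj
  have h := (hN A B j hj).comp (hL.tensorLeft_injective (A := A) hf hfg hg)
  refine Function.Injective.of_comp (f := tensorLeft B f) ?_
  convert h using 1
  funext z
  exact (tensorRight_comp_tensorLeft j f z).symm

lemma IsFlat.of_retract (hN : IsFlat R N) (i : M →ₗ[R] N) (p : N →ₗ[R] M)
    (h : p ∘ₗ i = LinearMap.id) : IsFlat R M := by
  intro A B _ _ _ _ j hj z z' hz
  have hi : Function.LeftInverse (tensorLeft A p) (tensorLeft A i) := fun z => by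
    rw [← tensorLeft_comp_apply, h, tensorLeft_id]; rfl
  refine hi.injective (hN A B j hj ?_)
  rw [tensorRight_comp_tensorLeft, tensorRight_comp_tensorLeft, hz]

end Characters

/-! ### Row-finite matrices that are exact over all injective right modules -/

section Matrices

open Finsupp

variable {R : Type u} [Ring R] {B : Type u}

/-- The map `a ↦ a f` on row vectors `a` of finite support with entries in a right module. -/
def rowMap (f : B → B →₀ R) {I : Type u} [AddCommGroup I] [Module Rᵐᵒᵖ I] :
    (B →₀ I) →+ (B →₀ I) :=
  Finsupp.liftAddHom fun b => AddMonoidHom.mk'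
    (fun x => (f b).mapRange (fun r => MulOpposite.op r • x) (by simp))
    fun x y => by ext t; simp

/-- The map `y ↦ f y` on column vectors `y` with entries in a left module. -/
def colMap (f : B → B →₀ R) {F : Type u} [AddCommGroup F] [Module R F] : (B → F) →+ (B → F) :=
  AddMonoidHom.mk' (fun y b => linearCombination R y (f b)) fun y z => by
    ext b
    simp [linearCombination_apply, Finsupp.sum_add]

/-- The row or column vector `a` vanishes outside of `S`. -/
abbrev SuppIn {I : Type u} [Zero I] (a : B → I) (S : Set B) : Prop := ∀ b, b ∉ S → a b = 0

section

variable (f : B → B →₀ R)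
variable {I J : Type u} [AddCommGroup I] [Module Rᵐᵒᵖ I] [AddCommGroup J] [Module Rᵐᵒᵖ J]
variable {F : Type u} [AddCommGroup F] [Module R F]

lemma colMap_apply (y : B → F) (b : B) : colMap f y b = linearCombination R y (f b) := rfl

lemma rowMap_single (b : B) (x : I) :
    rowMap f (single b x) = (f b).mapRange (fun r => MulOpposite.op r • x) (by simp) := by
  rw [rowMap, liftAddHom_apply_single]
  rfl

lemma rowMap_mapRange (g : I →ₗ[Rᵐᵒᵖ] J) (a : B →₀ I) :
    rowMap f (mapRange g g.map_zero a) = mapRange g g.map_zero (rowMap f a) := by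
  induction a using Finsupp.induction_linear with
  | zero => simp
  | add a b ha hb =>
    rw [mapRange_add (map_add g), map_add, map_add, mapRange_add (map_add g), ha, hb]
  | single b x =>
    rw [mapRange_single, rowMap_single, rowMap_single]
    ext t
    simp

lemma rowMap_rowMap (hsq : ∀ b, linearCombination R f (f b) = 0) (a : B →₀ I) :
    rowMap f (rowMap f a) = 0 := by
  induction a using Finsupp.induction_linear with
  | zero => simp
  | add a b ha hb => rw [map_add, map_add, ha, hb, add_zero]
  | single b x =>
    have key : ∀ v : B →₀ R, rowMap f (v.mapRange (fun r => MulOpposite.op r • x) (by simp)) =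
        (linearCombination R f v).mapRange (fun r => MulOpposite.op r • x) (by simp) := by
      intro v
      induction v using Finsupp.induction_linear with
      | zero => simp
      | add v w hv hw =>
        rw [mapRange_add (fun r s => by rw [MulOpposite.op_add, add_smul]), map_add, hv, hw,
          map_add, mapRange_add (fun r s => by rw [MulOpposite.op_add, add_smul])]
      | single s r =>
        rw [mapRange_single, rowMap_single, linearCombination_single]
        ext t
        simp [mul_smul]
    rw [rowMap_single, key, hsq]
    simp

lemma colMap_colMap (hsq : ∀ b, linearCombination R f (f b) = 0) (y : B → F) :
    colMap f (colMap f y) = 0 := by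
  funext b
  have key : ∀ v : B →₀ R, linearCombination R (colMap f y) v =
      linearCombination R y (linearCombination R f v) := by
    intro v
    induction v using Finsupp.induction_linear with
    | zero => simp
    | add v w hv hw => rw [map_add, map_add, map_add, hv, hw]
    | single s r => simp [colMap_apply]
  rw [colMap_apply, key, hsq, map_zero]
  rfl

lemma colMap_congr {y z : B → F} {b : B} (h : ∀ t, f b t ≠ 0 → y t = z t) :
    colMap f y b = colMap f z b := by
  rw [colMap_apply, colMap_apply, linearCombination_apply, linearCombination_apply]
  exact Finsupp.sum_congr fun t ht => by rw [h t (by simpa using ht)]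

lemma rowMap_suppIn {D : Set B} (hD : ∀ b ∈ D, ∀ t ∉ D, f b t = 0) {a : B →₀ I}
    (ha : SuppIn a D) : SuppIn (rowMap f a) D := by
  intro t ht
  rw [rowMap, liftAddHom_apply, Finsupp.sum, Finsupp.finsetSum_apply]
  refine Finset.sum_eq_zero fun b hb => ?_
  have hbD : b ∈ D := by
    by_contra h
    exact (mem_support_iff.1 hb) (ha b h)
  simp [hD b hbD t ht]

/-- The pairing of a row vector of characters of `F` with a column vector in `F`. -/
def pairing (y : B → F) : (B →₀ RightDual F) →+ AddCircle (1 : ℚ) :=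
  Finsupp.liftAddHom fun b => AddMonoidHom.mk' (fun χ : RightDual F => χ (y b)) fun _ _ => rfl

lemma pairing_single (y : B → F) (b : B) (χ : RightDual F) :
    pairing y (single b χ) = χ (y b) := by
  rw [pairing, liftAddHom_apply_single]
  rfl

lemma pairing_rowMap (y : B → F) (a : B →₀ RightDual F) :
    pairing y (rowMap f a) = pairing (colMap f y) a := by
  induction a using Finsupp.induction_linear with
  | zero => simp
  | add a b ha hb => rw [map_add, map_add, map_add, ha, hb]
  | single b χ =>
    have key : ∀ v : B →₀ R, pairing y (v.mapRange (fun r => MulOpposite.op r • χ) (by simp)) =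
        χ (linearCombination R y v) := by
      intro v
      induction v using Finsupp.induction_linear with
      | zero => simp
      | add v w hv hw =>
        rw [mapRange_add (fun r s => by rw [MulOpposite.op_add, add_smul]), map_add, hv, hw,
          map_add, map_add]
      | single s r =>
        rw [mapRange_single, pairing_single, linearCombination_single]
        rfl
    rw [rowMap_single, pairing_single, key, colMap_apply]

lemma pairing_eq_zero {y : B → F} {a : B →₀ RightDual F} (h : ∀ b, a b ≠ 0 → y b = 0) :
    pairing y a = 0 := by
  rw [pairing, liftAddHom_apply, Finsupp.sum]
  refine Finset.sum_eq_zero fun b hb => ?_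
  simp [h b (mem_support_iff.1 hb)]

end

/-- A square-zero row-finite matrix `f`, such that the complex `f : B →₀ I → B →₀ I` is exact
for every injective right module `I`. -/
structure IsInjExact (f : B → B →₀ R) : Prop where
  sq : ∀ b, linearCombination R f (f b) = 0
  exact : ∀ (I : ModuleCat.{u} Rᵐᵒᵖ), Module.Injective Rᵐᵒᵖ I → ∀ a : B →₀ I,
    rowMap f a = 0 → ∃ s, rowMap f s = a

/-- A set `D` of indices that spans a subcomplex which is again exact over all injective right
modules. -/
structure IsGood (f : B → B →₀ R) (D : Set B) : Prop where
  closed : ∀ b ∈ D, ∀ t ∉ D, f b t = 0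
  exact : ∀ (I : ModuleCat.{u} Rᵐᵒᵖ), Module.Injective Rᵐᵒᵖ I → ∀ a : B →₀ I, SuppIn a D →
    rowMap f a = 0 → ∃ s : B →₀ I, SuppIn s D ∧ rowMap f s = a

variable {f : B → B →₀ R} {D : Set B}

/-- Exactness of the quotient complex by a good set of indices. -/
lemma IsGood.exists_rowMap_sub (hf : IsInjExact f) (hD : IsGood f D) (I : ModuleCat.{u} Rᵐᵒᵖ)
    (hI : Module.Injective Rᵐᵒᵖ I) (a : B →₀ I) (ha : SuppIn (rowMap f a) D) :
    ∃ s : B →₀ I, SuppIn (rowMap f s - a) D := by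
  obtain ⟨d, hd, hda⟩ := hD.exact I hI _ ha (rowMap_rowMap f hf.sq a)
  obtain ⟨s, hs⟩ := hf.exact I hI (a - d) (by rw [map_sub, hda, sub_self])
  exact ⟨s, fun b hb => by simp [hs, hd b hb]⟩

/-- Exactness over all injectives is uniform: cycles supported on a finite set `T` bound chains
supported on a finite set `S` that depends on `T` only. Otherwise, counterexamples for the various
`S`, taken together, would give a counterexample over a product of injective modules. -/
lemma IsGood.exists_finset (hf : IsInjExact f) (hD : IsGood f D) (T : Finset B) :
    ∃ S : Finset B, ∀ (I : ModuleCat.{u} Rᵐᵒᵖ), Module.Injective Rᵐᵒᵖ I → ∀ a : B →₀ I,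
      SuppIn a T → SuppIn (rowMap f a) D →
        ∃ s : B →₀ I, SuppIn s S ∧ SuppIn (rowMap f s - a) D := by
  by_contra! H
  choose I hI a haT haD hs using H
  let J : ModuleCat.{u} Rᵐᵒᵖ := ModuleCat.of Rᵐᵒᵖ (∀ S, I S)
  have hJ : Module.Injective Rᵐᵒᵖ J := by
    have := hI
    exact Module.Injective.pi Rᵐᵒᵖ (fun S => I S)
  let p (S : Finset B) : J →ₗ[Rᵐᵒᵖ] I S := LinearMap.proj S
  let A : B →₀ J := Finsupp.onFinset T (fun b S => a S b) fun b hb => by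
    by_contra hbT
    exact hb (funext fun S => haT S b hbT)
  have hA : ∀ S, mapRange (p S) (p S).map_zero A = a S := fun S => by ext b; rfl
  obtain ⟨s, hs'⟩ := hD.exists_rowMap_sub hf J hJ A fun b hb => funext fun S => by
    have h : p S (rowMap f A b) = 0 := by
      rw [← mapRange_apply (hf := (p S).map_zero), ← rowMap_mapRange, hA]
      exact haD S b hb
    exact h
  refine hs s.support (mapRange (p s.support) (p s.support).map_zero s)
    (fun b hb => by simpa using congrArg (p s.support) (notMem_support_iff.1 hb)) fun b hb => ?_
  have h := congrArg (p s.support) (hs' b hb)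
  rw [rowMap_mapRange, ← hA s.support]
  simpa using h

end Matrices

/-! ### Exactness of the complex of column vectors over a flat module -/

section Devissage

open Finsupp

variable {R : Type u} [Ring R] {B : Type u} {f : B → B →₀ R} {D : Set B}
variable {F : Type u} [AddCommGroup F] [Module R F]

lemma pairing_piSingle [DecidableEq B] (t : B) (x : F) (a : B →₀ RightDual F) :
    pairing (Pi.single t x) a = a t x := by
  induction a using Finsupp.induction_linear with
  | zero => simp
  | add a b ha hb => rw [map_add, ha, hb]; rfl
  | single b χ =>
    rw [pairing_single]
    by_cases h : b = t
    · subst h; simp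
    · rw [Pi.single_eq_of_ne h, single_eq_of_ne (Ne.symm h), map_zero]
      rfl

/-- Row vectors supported on `T` that are cycles modulo `D` bound chains supported on `S`. -/
def Bounds (f : B → B →₀ R) (D : Set B) (T S : Finset B) : Prop :=
  ∀ (I : ModuleCat.{u} Rᵐᵒᵖ), Module.Injective Rᵐᵒᵖ I → ∀ a : B →₀ I,
    SuppIn a T → SuppIn (rowMap f a) D →
      ∃ s : B →₀ I, SuppIn s S ∧ SuppIn (rowMap f s - a) D

/-- The dual form of uniform exactness: a column vector `y` that is a cycle on `S` is a boundary
on `T`. A character separating `y` from the boundaries would be a cycle with entries in `F⁺`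
supported on `T`, hence the boundary of a chain supported on `S`, and so would kill `y`. -/
lemma Bounds.exists_colMap_eq {T S : Finset B} (h : Bounds f D T S)
    (hF : Module.Injective Rᵐᵒᵖ (RightDual F)) (y : B → F) (hyD : ∀ b ∈ D, y b = 0)
    (hyS : ∀ b ∈ S, colMap f y b = 0) :
    ∃ w : B → F, (∀ b ∈ D, w b = 0) ∧ ∀ b ∈ T, colMap f w b = y b := by
  classical
  let H : AddSubgroup (T → F) :=
    { carrier := {v | ∃ w : B → F, (∀ b ∈ D, w b = 0) ∧ ∀ b : T, colMap f w b = v b}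
      zero_mem' := ⟨0, fun _ _ => rfl, fun b => by simp⟩
      add_mem' := by
        rintro v v' ⟨w, hw, hv⟩ ⟨w', hw', hv'⟩
        exact ⟨w + w', fun b hb => by simp [hw b hb, hw' b hb], fun b => by simp [hv, hv']⟩
      neg_mem' := by
        rintro v ⟨w, hw, hv⟩
        exact ⟨-w, fun b hb => by simp [hw b hb], fun b => by simp [hv]⟩ }
  by_contra hne
  obtain ⟨χ, hχ, hχy⟩ := exists_character_of_notMem H (x := fun b : T => y b) fun hy => by
    obtain ⟨w, hw, hv⟩ := hy
    exact hne ⟨w, hw, fun b hb => hv ⟨b, hb⟩⟩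
  let a : B →₀ RightDual F := Finsupp.onFinset T
    (fun b => if hb : b ∈ T then χ.comp (AddMonoidHom.single (fun _ : T => F) ⟨b, hb⟩) else 0)
    fun b hb => by
      by_contra hbT
      exact hb (dif_neg hbT)
  have ha : ∀ z : B → F, pairing z a = χ fun b : T => z b := by
    intro z
    rw [pairing, liftAddHom_apply]
    refine (Finsupp.onFinset_sum _ fun b => by simp).trans ?_
    rw [← Finset.univ_sum_single (fun b : T => z b), map_sum, ← Finset.sum_coe_sort T]
    refine Finset.sum_congr rfl fun b _ => ?_
    have hb : a b = χ.comp (AddMonoidHom.single (fun _ : T => F) b) := dif_pos b.2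
    exact DFunLike.congr_fun hb (z b)
  obtain ⟨s, hs, hsa⟩ := h (ModuleCat.of Rᵐᵒᵖ (RightDual F)) hF a (fun b hb => dif_neg hb) <| by
    intro t ht
    refine RightDual.ext fun x => ?_
    have hx := pairing_piSingle t x (rowMap f a)
    have htD : ∀ b ∈ D, (Pi.single t x : B → F) b = 0 := by
      intro b hb
      have hbt : b ≠ t := by rintro rfl; exact ht hb
      simp [hbt]
    rw [pairing_rowMap, ha, hχ _ ⟨Pi.single t x, htD, fun _ => rfl⟩] at hx
    exact hx.symm
  apply hχy
  have hy : a = rowMap f s - (rowMap f s - a) := by abel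
  rw [← ha, hy, map_sub, pairing_rowMap, pairing_eq_zero, pairing_eq_zero, sub_zero]
  · exact fun b hb => hyD b (by_contra fun hbD => hb (hsa b hbD))
  · exact fun b hb => hyS b (by_contra fun hbS => hb (hs b hbS))

/-- Any good set of indices is contained in a good set which contains a given index, and to which
the solutions of `f w = h` extend. The new indices are a countable union of finite sets `T n`, where
`T (n + 1)` is large enough for cycles on `T n` to bound on it; this allows one to correct solutions
on `T (n + 1)` so that they agree on `T n` with the previous ones. -/
lemma IsGood.exists_extension (hf : IsInjExact f) (hD : IsGood f D) (b₀ : B) :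
    ∃ C : Set B, D ⊆ C ∧ b₀ ∈ C ∧ IsGood f C ∧
      ∀ (F : Type u) [AddCommGroup F] [Module R F], Module.Injective Rᵐᵒᵖ (RightDual F) →
        ∀ h : B → F, colMap f h = 0 → (∀ b ∈ D, h b = 0) →
          ∃ w : B → F, (∀ b ∈ D, w b = 0) ∧ ∀ b ∈ C, colMap f w b = h b := by
  classical
  choose S hS using fun T => hD.exists_finset hf T
  have hS : ∀ T, Bounds f D T (S T) := hS
  obtain ⟨T, hT₀, hTsucc⟩ : ∃ T : ℕ → Finset B, T 0 = {b₀} ∧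
      ∀ n, T (n + 1) = T n ∪ S (T n) ∪ (T n).biUnion fun b => (f b).support :=
    ⟨fun n => Nat.rec {b₀} (fun _ T => T ∪ S T ∪ T.biUnion fun b => (f b).support) n,
      rfl, fun _ => rfl⟩
  have hTmono : Monotone T := monotone_nat_of_le_succ fun n => by
    rw [hTsucc, Finset.union_assoc]
    exact Finset.subset_union_left
  have hTS : ∀ n, S (T n) ⊆ T (n + 1) := fun n => by
    rw [hTsucc]
    exact Finset.subset_union_right.trans Finset.subset_union_left
  have hTf : ∀ n, ∀ b ∈ T n, ∀ t, f b t ≠ 0 → t ∈ T (n + 1) := fun n b hb t ht => by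
    rw [hTsucc]
    exact Finset.mem_union_right _ (Finset.mem_biUnion.2 ⟨b, hb, mem_support_iff.2 ht⟩)
  have hfin : ∀ A : Finset B, (∀ b ∈ A, ∃ n, b ∈ T n) → ∃ n, A ⊆ T n := by
    intro A
    induction A using Finset.induction_on with
    | empty => exact fun _ => ⟨0, by simp⟩
    | insert b A _ ih =>
      intro hA
      obtain ⟨n, hn⟩ := ih fun b hb => hA b (Finset.mem_insert_of_mem hb)
      obtain ⟨m, hm⟩ := hA b (Finset.mem_insert_self b A)
      exact ⟨max n m, Finset.insert_subset (hTmono (le_max_right n m) hm)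
        (hn.trans (hTmono (le_max_left n m)))⟩
  refine ⟨D ∪ {b | ∃ n, b ∈ T n}, Set.subset_union_left,
    Or.inr ⟨0, by simp [hT₀]⟩, ⟨?_, ?_⟩, ?_⟩
  · rintro b (hb | ⟨n, hb⟩) t ht
    · exact hD.closed b hb t fun h => ht (Or.inl h)
    · by_contra hne
      exact ht (Or.inr ⟨n + 1, hTf n b hb t hne⟩)
  · intro I hI a ha ha0
    obtain ⟨n, hn⟩ := hfin (a.support.filter fun b => b ∉ D) fun b hb => by
      obtain ⟨hb, hbD⟩ := Finset.mem_filter.1 hb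
      by_contra hbT
      exact mem_support_iff.1 hb (ha b fun h => h.elim hbD hbT)
    -- Split the cycle into a part on `T n` and a part on `D`.
    let a₁ := a.filter fun b => b ∉ D
    let a₂ := a.filter fun b => ¬ b ∉ D
    have ha₁₂ : a₁ + a₂ = a := filter_add_filter_not a _
    have ha₁ : SuppIn a₁ (T n : Set B) := fun b hb => by
      by_contra hne
      have hne' := mem_support_iff.2 hne
      rw [support_filter] at hne'
      exact hb (hn hne')
    have ha₂ : SuppIn a₂ D := fun b hb => filter_apply_neg _ _ (by simpa using hb)
    have hr : rowMap f a₁ = - rowMap f a₂ := by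
      rw [eq_neg_iff_add_eq_zero, ← map_add, ha₁₂, ha0]
    obtain ⟨s, hs, hsa⟩ := hS (T n) I hI a₁ ha₁ fun b hb => by
      rw [hr, coe_neg, Pi.neg_apply, rowMap_suppIn f hD.closed ha₂ b hb, neg_zero]
    obtain ⟨d, hd, hda⟩ := hD.exact I hI (a - rowMap f s)
      (fun b hb => by
        have h1 := hsa b hb
        have h2 := ha₂ b hb
        rw [← ha₁₂]
        simp only [coe_add, coe_sub, Pi.add_apply, Pi.sub_apply] at h1 ⊢
        rw [h2, add_zero, ← neg_sub, h1, neg_zero])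
      (by rw [map_sub, ha0, rowMap_rowMap f hf.sq, sub_zero])
    refine ⟨s + d, fun b hb => ?_, by rw [map_add, hda, add_sub_cancel]⟩
    have hb₁ : b ∉ S (T n) := fun h => hb (Or.inr ⟨n + 1, hTS n h⟩)
    simp [hs b hb₁, hd b fun h => hb (Or.inl h)]
  · intro F _ _ hF h hh hhD
    -- Solve the equation on all `T n`; a solution on `T (n + 2)` is then corrected by a boundary
    -- so as to agree on `T n` with a given solution on `T (n + 1)`.
    have hsol : ∀ n, ∃ w : B → F, (∀ b ∈ D, w b = 0) ∧ ∀ b ∈ T n, colMap f w b = h b := fun n =>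
      (hS (T n)).exists_colMap_eq hF h hhD fun b _ => congrFun hh b
    have hstep : ∀ n, ∀ w : B → F, (∀ b ∈ D, w b = 0) ∧ (∀ b ∈ T (n + 1), colMap f w b = h b) →
        ∃ w' : B → F, ((∀ b ∈ D, w' b = 0) ∧ (∀ b ∈ T (n + 2), colMap f w' b = h b)) ∧
          ∀ b ∈ T n, w' b = w b := by
      rintro n w ⟨hwD, hw⟩
      obtain ⟨w₁, hw₁D, hw₁⟩ := hsol (n + 2)
      obtain ⟨v, hvD, hv⟩ := (hS (T n)).exists_colMap_eq hF (w₁ - w)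
        (fun b hb => by simp [hwD b hb, hw₁D b hb]) fun b hb => by
          have hb' := hTS n hb
          rw [map_sub, Pi.sub_apply, hw b hb', hw₁ b (hTmono (Nat.le_succ (n + 1)) hb'), sub_self]
      refine ⟨w₁ - colMap f v, ⟨fun b hb => ?_, fun b hb => ?_⟩, fun b hb => ?_⟩
      · rw [Pi.sub_apply, hw₁D b hb, zero_sub, neg_eq_zero, colMap_congr f (z := 0)]
        · simp
        · exact fun t ht => hvD t (by_contra fun h => ht (hD.closed b hb t h))
      · rw [map_sub, colMap_colMap f hf.sq, sub_zero, hw₁ b hb]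
      · simp [hv b hb]
    choose! next hnext hagree using hstep
    obtain ⟨w₀, hw₀⟩ := hsol 1
    let w : ℕ → B → F := fun n => Nat.rec w₀ (fun n w => next n w) n
    have hw : ∀ n, (∀ b ∈ D, w n b = 0) ∧ ∀ b ∈ T (n + 1), colMap f (w n) b = h b := by
      intro n
      induction n with
      | zero => exact hw₀
      | succ n ih => exact hnext n (w n) ih
    have hconst : ∀ n m, n ≤ m → ∀ b ∈ T n, w m b = w n b := by
      intro n m hnm
      induction m, hnm using Nat.le_induction with
      | base => exact fun _ _ => rfl
      | succ m hnm ih =>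
        exact fun b hb => (hagree m (w m) (hw m) b (hTmono hnm hb)).trans (ih b hb)
    let W : B → F := fun b => if hb : ∃ n, b ∈ T n then w (Nat.find hb) b else 0
    have hW : ∀ n, ∀ b ∈ T n, W b = w n b := fun n b hb => by
      have hb' : ∃ n, b ∈ T n := ⟨n, hb⟩
      simp only [W, dif_pos hb']
      exact (hconst _ n (Nat.find_min' hb' hb) b (Nat.find_spec hb')).symm
    have hWD : ∀ b ∈ D, W b = 0 := fun b hb => by
      by_cases hb' : ∃ n, b ∈ T n
      · simp only [W, dif_pos hb', (hw _).1 b hb]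
      · simp only [W, dif_neg hb']
    refine ⟨W, hWD, ?_⟩
    rintro b (hb | ⟨n, hb⟩)
    · rw [hhD b hb, colMap_congr f (z := 0)]
      · simp
      · exact fun t ht => hWD t (by_contra fun h => ht (hD.closed b hb t h))
    · rw [colMap_congr f fun t ht => hW (n + 1) t (hTf n b hb t ht)]
      exact (hw (n + 1)).2 b (hTmono (show n ≤ n + 2 by lia) hb)

/-- For a matrix which is exact over all injective right modules, the complex of column vectors
with entries in a flat left module `F` is exact: solutions on good sets of indices extend, so that
a maximal one is defined everywhere. -/
theorem IsInjExact.exists_colMap_eq (hf : IsInjExact f)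
    (hF : Module.Injective Rᵐᵒᵖ (RightDual F)) (h : B → F) (hh : colMap f h = 0) :
    ∃ w : B → F, colMap f w = h := by
  classical
  let X := {p : Set B × (B → F) // IsGood f p.1 ∧ ∀ b ∈ p.1, colMap f p.2 b = h b}
  let r : X → X → Prop := fun p q => p.1.1 ⊆ q.1.1 ∧ ∀ b ∈ p.1.1, q.1.2 b = p.1.2 b
  obtain ⟨⟨⟨D, w⟩, hD, hw⟩, hmax⟩ : ∃ m : X, ∀ a, r m a → r a m := by
    refine exists_maximal_of_chains_bounded (fun c hc => ?_) fun {p q s} hpq hqs =>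
      ⟨hpq.1.trans hqs.1, fun b hb => (hqs.2 b (hpq.1 hb)).trans (hpq.2 b hb)⟩
    rcases c.eq_empty_or_nonempty with rfl | hne
    · refine ⟨⟨⟨∅, 0⟩, ⟨by simp, fun I hI a ha _ => ⟨0, fun _ _ => rfl, ?_⟩⟩, by simp⟩, by simp⟩
      rw [map_zero]
      ext b
      exact (ha b (by simp)).symm
    let D : Set B := {b | ∃ p ∈ c, b ∈ p.1.1}
    let w : B → F := fun b => if hb : ∃ p ∈ c, b ∈ p.1.1 then hb.choose.1.2 b else 0
    have hdir : ∀ p ∈ c, ∀ q ∈ c, ∃ s ∈ c, r p s ∧ r q s := by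
      intro p hp q hq
      rcases eq_or_ne p q with rfl | hpq
      · exact ⟨p, hp, ⟨subset_rfl, fun _ _ => rfl⟩, ⟨subset_rfl, fun _ _ => rfl⟩⟩
      rcases hc hp hq hpq with h | h
      · exact ⟨q, hq, h, ⟨subset_rfl, fun _ _ => rfl⟩⟩
      · exact ⟨p, hp, ⟨subset_rfl, fun _ _ => rfl⟩, h⟩
    have hw : ∀ p ∈ c, ∀ b ∈ p.1.1, w b = p.1.2 b := by
      intro p hp b hb
      have hb' : ∃ p ∈ c, b ∈ p.1.1 := ⟨p, hp, hb⟩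
      obtain ⟨s, -, hs, hs'⟩ := hdir p hp _ hb'.choose_spec.1
      simp only [w, dif_pos hb']
      rw [← hs.2 b hb, hs'.2 b hb'.choose_spec.2]
    have hfin : ∀ A : Finset B, (∀ b ∈ A, b ∈ D) → ∃ p ∈ c, ∀ b ∈ A, b ∈ p.1.1 := by
      intro A
      induction A using Finset.induction_on with
      | empty =>
        obtain ⟨p, hp⟩ := hne
        exact fun _ => ⟨p, hp, by simp⟩
      | insert b A _ ih =>
        intro hA
        obtain ⟨p, hp, hpA⟩ := ih fun b hb => hA b (Finset.mem_insert_of_mem hb)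
        obtain ⟨q, hq, hqb⟩ := hA b (Finset.mem_insert_self b A)
        obtain ⟨s, hs, hps, hqs⟩ := hdir p hp q hq
        refine ⟨s, hs, fun x hx => ?_⟩
        rcases Finset.mem_insert.1 hx with rfl | hx
        · exact hqs.1 hqb
        · exact hps.1 (hpA x hx)
    refine ⟨⟨⟨D, w⟩, ⟨?_, ?_⟩, ?_⟩, fun p hp => ⟨fun b hb => ⟨p, hp, hb⟩, hw p hp⟩⟩
    · rintro b ⟨p, hp, hb⟩ t ht
      exact p.2.1.closed b hb t fun h => ht ⟨p, hp, h⟩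
    · intro I hI a ha ha0
      obtain ⟨p, hp, hpa⟩ := hfin a.support fun b hb => by
        by_contra h
        exact mem_support_iff.1 hb (ha b h)
      obtain ⟨s, hs, hsa⟩ := p.2.1.exact I hI a (fun b hb => by
        by_contra h
        exact hb (hpa b (mem_support_iff.2 h))) ha0
      exact ⟨s, fun b hb => hs b fun h => hb ⟨p, hp, h⟩, hsa⟩
    · rintro b ⟨p, hp, hb⟩
      rw [← p.2.2 b hb]
      exact colMap_congr f fun t ht => hw p hp t
        (by_contra fun h => ht (p.2.1.closed b hb t h))
  dsimp only at hD hw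
  by_cases hall : ∀ b, b ∈ D
  · exact ⟨w, funext fun b => hw b (hall b)⟩
  push Not at hall
  obtain ⟨b₀, hb₀⟩ := hall
  -- On the larger set `C`, solve the equation for the error of `w`, which vanishes on `D`.
  obtain ⟨C, hDC, hb₀C, hC, hext⟩ := hD.exists_extension hf b₀
  obtain ⟨v, hvD, hv⟩ := hext F hF (h - colMap f w)
    (by rw [map_sub, hh, colMap_colMap f hf.sq, sub_zero])
    fun b hb => by rw [Pi.sub_apply, hw b hb, sub_self]
  have hle := hmax ⟨⟨C, w + v⟩, hC, fun b hb => by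
    rw [map_add, Pi.add_apply, hv b hb, Pi.sub_apply, add_sub_cancel]⟩
    ⟨hDC, fun b hb => by simp [hvD b hb]⟩
  exact absurd (hle.1 hb₀C) hb₀

end Devissage

/-! ### Complexes of projective modules -/

section Free

open Finsupp

variable {R : Type u} [Ring R]
variable {A : Type u} [AddCommGroup A] [Module Rᵐᵒᵖ A] {B : Type u}

/-- The map `A ⊗_R R^(B) → A^(B)`. -/
def tensorFree : Tensor R A (B →₀ R) →+ (B →₀ A) :=
  tensorLift
    (AddMonoidHom.mk' (fun a => AddMonoidHom.mk'
        (fun v : B →₀ R => v.mapRange (fun r => MulOpposite.op r • a) (by simp))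
        fun v w => by ext; simp [add_smul])
      fun a a' => by ext; simp)
    fun a r v => by ext; simp [mul_smul]

@[simp] lemma tensorFree_tmk (a : A) (v : B →₀ R) :
    tensorFree (tmk R a v) = v.mapRange (fun r => MulOpposite.op r • a) (by simp) := rfl

/-- The map `A^(B) → A ⊗_R R^(B)`, inverse to `tensorFree`. -/
def tensorFreeSymm : (B →₀ A) →+ Tensor R A (B →₀ R) :=
  Finsupp.liftAddHom fun b => (tmkHom (R := R)).flip (single b (1 : R))

@[simp] lemma tensorFreeSymm_single (b : B) (a : A) :
    tensorFreeSymm (R := R) (single b a) = tmk R a (single b 1) := by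
  rw [tensorFreeSymm, liftAddHom_apply_single]
  rfl

lemma tensorFree_tensorFreeSymm (a : B →₀ A) : tensorFree (R := R) (tensorFreeSymm a) = a := by
  induction a using Finsupp.induction_linear with
  | zero => simp
  | add a b ha hb => rw [map_add, map_add, ha, hb]
  | single b x => simp

lemma tensorFreeSymm_tensorFree (z : Tensor R A (B →₀ R)) :
    tensorFreeSymm (tensorFree z) = z := by
  induction z using tensor_induction with
  | add x y hx hy => rw [map_add, map_add, hx, hy]
  | tmul a v =>
    suffices h : (tensorFreeSymm.comp tensorFree).comp (tmkHom a) =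
        tmkHom (R := R) (M := B →₀ R) a from DFunLike.congr_fun h v
    refine Finsupp.addHom_ext fun b r => ?_
    simp [tmk_smul]

lemma tensorFree_tensorLeft (φ : (B →₀ R) →ₗ[R] (B →₀ R)) (z : Tensor R A (B →₀ R)) :
    tensorFree (tensorLeft A φ z) = rowMap (fun b => φ (single b 1)) (tensorFree z) := by
  induction z using tensor_induction with
  | add x y hx hy => rw [map_add, map_add, map_add, map_add, hx, hy]
  | tmul a v =>
    suffices h : (tensorFree.comp (tensorLeft A φ)).comp (tmkHom a) =
        ((rowMap fun b => φ (single b 1)).comp tensorFree).comp (tmkHom (R := R) a) from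
      DFunLike.congr_fun h v
    refine Finsupp.addHom_ext fun b r => ?_
    have hr : single b r = r • single b (1 : R) := by simp
    simp only [AddMonoidHom.comp_apply, tmkHom_apply, tensorLeft_tmk, tensorFree_tmk,
      mapRange_single, rowMap_single]
    rw [hr, map_smul]
    ext t
    simp [mul_smul]

/-- The matrix of a square-zero endomorphism of a free module. -/
lemma isInjExact_of_linearMap (φ : (B →₀ R) →ₗ[R] (B →₀ R)) (hφ : φ ∘ₗ φ = 0)
    (hex : ∀ I : ModuleCat.{u} Rᵐᵒᵖ, Module.Injective Rᵐᵒᵖ I →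
      Function.Exact (tensorLeft I φ) (tensorLeft I φ)) :
    IsInjExact fun b => φ (single b 1) where
  sq b := by
    have h : linearCombination R (fun b => φ (single b 1)) = φ := by ext; simp
    rw [h]
    exact LinearMap.congr_fun hφ _
  exact I hI a ha := by
    obtain ⟨s, hs⟩ := (hex I hI (tensorFreeSymm a)).1 (by
      rw [← tensorFreeSymm_tensorFree (tensorLeft I φ _), tensorFree_tensorLeft,
        tensorFree_tensorFreeSymm, ha, map_zero])
    refine ⟨tensorFree s, ?_⟩
    rw [← tensorFree_tensorLeft, hs, tensorFree_tensorFreeSymm]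

lemma isFlat_finsupp : IsFlat R (B →₀ R) := by
  intro A A' _ _ _ _ g hg
  rw [injective_iff_map_eq_zero]
  intro z hz
  have key : ∀ z : Tensor R A (B →₀ R), tensorFree (tensorRight (B →₀ R) g z) =
      mapRange g g.map_zero (tensorFree z) := by
    intro z
    induction z using tensor_induction with
    | add x y hx hy =>
      rw [map_add, map_add, map_add, hx, hy, mapRange_add (map_add g)]
    | tmul a v => ext; simp
  have h0 := key z
  rw [hz, map_zero] at h0
  have h1 : tensorFree z = 0 := mapRange_injective g g.map_zero hg (by rw [← h0, mapRange_zero])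
  rw [← tensorFreeSymm_tensorFree z, h1, map_zero]

lemma isFlat_of_projective (P : Type u) [AddCommGroup P] [Module R P] [Module.Projective R P] :
    IsFlat R P := by
  obtain ⟨s, hs⟩ := (Module.projective_def' (R := R) (P := P)).1 inferInstance
  exact isFlat_finsupp.of_retract s _ hs

end Free

section Periodic

open Finsupp

variable {R : Type u} [Ring R] {X : Type u} [AddCommGroup X] [Module R X]
variable {F : Type u} [AddCommGroup F] [Module R F]

/-- Exactness after tensoring passes to a complex which is a sum of copies of a given one, up to a
contractible summand with contraction `k`. -/
lemma exact_tensorLeft_of_decomposition {P : Type u} [AddCommGroup P] [Module R P]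
    {d : X →ₗ[R] X} {ψ k : P →ₗ[R] P} (i₁ i₂ : X →ₗ[R] P) (p₁ p₂ : P →ₗ[R] X)
    (hψ : ψ ∘ₗ ψ = 0) (hi₁ : ψ ∘ₗ i₁ = i₁ ∘ₗ d) (hi₂ : ψ ∘ₗ i₂ = i₂ ∘ₗ d)
    (hp₁ : p₁ ∘ₗ ψ = d ∘ₗ p₁) (hp₂ : p₂ ∘ₗ ψ = d ∘ₗ p₂)
    (hid : LinearMap.id = i₁ ∘ₗ p₁ + i₂ ∘ₗ p₂ + (ψ ∘ₗ k + k ∘ₗ ψ))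
    {A : Type u} [AddCommGroup A] [Module Rᵐᵒᵖ A]
    (h : Function.Exact (tensorLeft A d) (tensorLeft A d)) :
    Function.Exact (tensorLeft A ψ) (tensorLeft A ψ) := by
  intro z
  constructor
  · intro hz
    obtain ⟨x₁, hx₁⟩ := (h (tensorLeft A p₁ z)).1 (by
      rw [← tensorLeft_comp_apply, ← hp₁, tensorLeft_comp_apply, hz, map_zero])
    obtain ⟨x₂, hx₂⟩ := (h (tensorLeft A p₂ z)).1 (by
      rw [← tensorLeft_comp_apply, ← hp₂, tensorLeft_comp_apply, hz, map_zero])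
    refine ⟨tensorLeft A i₁ x₁ + tensorLeft A i₂ x₂ + tensorLeft A k z, ?_⟩
    have hz' : tensorLeft A (LinearMap.id : P →ₗ[R] P) z = z := by rw [tensorLeft_id]; rfl
    rw [hid] at hz'
    simp only [tensorLeft_add, AddMonoidHom.add_apply, tensorLeft_comp_apply, hz, map_zero,
      add_zero, ← hx₁, ← hx₂] at hz'
    conv_rhs => rw [← hz']
    simp only [map_add, ← tensorLeft_comp_apply, hi₁, hi₂]
  · rintro ⟨z, rfl⟩
    rw [← tensorLeft_comp_apply, hψ, tensorLeft_zero]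
    rfl

/-- If a periodic complex of projectives is exact after tensoring with injectives, then it is
exact after applying `Hom(_, F)` for `F` flat. With `L = X ⊕ Q` free, the complex `X ⊕ X ⊕ Q ⊕ Q`,
with the identity `Q → Q` as the last part of the differential, is a complex of free modules. -/
theorem exists_comp_eq_of_periodic [Module.Projective R X] (d : X →ₗ[R] X) (hd : d ∘ₗ d = 0)
    (hex : ∀ I : ModuleCat.{u} Rᵐᵒᵖ, Module.Injective Rᵐᵒᵖ I →
      Function.Exact (tensorLeft I d) (tensorLeft I d))
    (hF : IsFlat R F) (h : X →ₗ[R] F) (hh : h ∘ₗ d = 0) : ∃ w : X →ₗ[R] F, w ∘ₗ d = h := by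
  obtain ⟨s, hs⟩ := (Module.projective_def' (R := R) (P := X)).1 inferInstance
  let L := X →₀ R
  let p : L →ₗ[R] X := linearCombination R id
  have hps : ∀ x, p (s x) = x := LinearMap.congr_fun hs
  have hdd : ∀ x, d (d x) = 0 := LinearMap.congr_fun hd
  have hhd : ∀ x, h (d x) = 0 := LinearMap.congr_fun hh
  let c : L →ₗ[R] L := LinearMap.id - s ∘ₗ p
  have hc : ∀ l, c l = l - s (p l) := fun _ => rfl
  let ψ : L × L →ₗ[R] L × L :=
    ((s ∘ₗ d ∘ₗ p).coprod c).prod (s ∘ₗ d ∘ₗ p ∘ₗ LinearMap.snd R L L)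
  have hψ : ∀ l, ψ l = (s (d (p l.1)) + c l.2, s (d (p l.2))) := fun _ => rfl
  have hψψ : ψ ∘ₗ ψ = 0 := by
    refine LinearMap.ext fun l => ?_
    simp [hψ, hc, hps, hdd]
  let e : (X ⊕ X →₀ R) ≃ₗ[R] L × L := sumFinsuppLEquivProdFinsupp R
  let φ : (X ⊕ X →₀ R) →ₗ[R] (X ⊕ X →₀ R) := e.symm.toLinearMap ∘ₗ ψ ∘ₗ e.toLinearMap
  have hφ : ∀ v, φ v = e.symm (ψ (e v)) := fun _ => rfl
  have hφφ : φ ∘ₗ φ = 0 := by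
    refine LinearMap.ext fun v => ?_
    have := LinearMap.congr_fun hψψ (e v)
    simp only [LinearMap.comp_apply, LinearMap.zero_apply] at this
    simp [hφ, this]
  have hmat := isInjExact_of_linearMap φ hφφ fun I hI =>
    exact_tensorLeft_of_decomposition (d := d)
      (k := e.symm.toLinearMap ∘ₗ LinearMap.inr R L L ∘ₗ c ∘ₗ LinearMap.fst R L L ∘ₗ e.toLinearMap)
      (e.symm.toLinearMap ∘ₗ LinearMap.inl R L L ∘ₗ s)
      (e.symm.toLinearMap ∘ₗ LinearMap.inr R L L ∘ₗ s)
      (p ∘ₗ LinearMap.fst R L L ∘ₗ e.toLinearMap) (p ∘ₗ LinearMap.snd R L L ∘ₗ e.toLinearMap)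
      hφφ
      (LinearMap.ext fun x => by simp [hφ, hψ, hc, hps])
      (LinearMap.ext fun x => by simp [hφ, hψ, hc, hps])
      (LinearMap.ext fun x => by simp [hφ, hψ, hc, hps])
      (LinearMap.ext fun x => by simp [hφ, hψ, hps])
      (LinearMap.ext fun x => by
        apply e.injective
        simp [hφ, hψ, hc, hps])
      (hex I hI)
  let h' : (X ⊕ X →₀ R) →ₗ[R] F := h ∘ₗ p ∘ₗ LinearMap.fst R L L ∘ₗ e.toLinearMap
  obtain ⟨w, hw⟩ := hmat.exists_colMap_eq hF.injective_rightDual (fun b => h' (single b 1)) <| by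
    funext b
    have hl : linearCombination R (fun b => h' (single b 1)) = h' := by ext; simp
    rw [colMap_apply, hl]
    simp [h', hφ, hψ, hc, hps, hhd]
  have hw' : linearCombination R w ∘ₗ φ = h' := by
    refine Finsupp.lhom_ext fun b r => ?_
    have hr : single b r = r • single b (1 : R) := by simp
    rw [hr, map_smul, map_smul]
    exact congrArg (r • ·) (congrFun hw b)
  refine ⟨linearCombination R w ∘ₗ e.symm.toLinearMap ∘ₗ LinearMap.inl R L L ∘ₗ s,
    LinearMap.ext fun x => ?_⟩
  have := LinearMap.congr_fun hw' (e.symm (s x, 0))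
  simpa [h', hφ, hψ, hc, hps] using this

end Periodic

/-! ### Direct sums and unbounded complexes -/

section DirectSums

variable {R : Type u} [Ring R] {ι : Type} [DecidableEq ι] {X : ι → ModuleCat.{u} R}

/-- Every element of `A ⊗_R (⨁ X i)` is the sum of finitely many components. -/
lemma exists_sum_tensor_dfinsupp {A : Type u} [AddCommGroup A] [Module Rᵐᵒᵖ A]
    (z : Tensor R A (Π₀ i, X i)) :
    ∃ s : Finset ι, ∀ t, s ⊆ t → ∑ i ∈ t, tensorLeft A
      (DFinsupp.lsingle (R := R) i) (tensorLeft A (DFinsupp.lapply (R := R) i) z) = z := by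
  classical
  induction z using tensor_induction with
  | tmul a v =>
    refine ⟨v.support, fun t ht => ?_⟩
    have hv : ∑ i ∈ t, DFinsupp.single i (v i) = v := by
      ext j
      rw [DFinsupp.finsetSum_apply]
      by_cases hj : j ∈ t
      · rw [Finset.sum_eq_single j]
        · simp
        · exact fun i _ hij => DFinsupp.single_eq_of_ne hij.symm
        · exact fun h => absurd hj h
      · have hvj : v j = 0 := by
          by_contra h
          exact hj (ht (DFinsupp.mem_support_iff.2 h))
        rw [hvj]
        refine Finset.sum_eq_zero fun i hi => DFinsupp.single_eq_of_ne ?_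
        rintro rfl
        exact hj hi
    have := congrArg (tmkHom (R := R) a) hv
    rw [map_sum] at this
    exact this
  | add x y hx hy =>
    obtain ⟨s, hs⟩ := hx
    obtain ⟨s', hs'⟩ := hy
    refine ⟨s ∪ s', fun t ht => ?_⟩
    simp only [map_add, Finset.sum_add_distrib]
    rw [hs t (Finset.union_subset_left ht), hs' t (Finset.union_subset_right ht)]

lemma isFlat_dfinsupp (hX : ∀ i, IsFlat R (X i)) : IsFlat R (Π₀ i, X i) := by
  intro A A' _ _ _ _ g hg
  rw [injective_iff_map_eq_zero]
  intro z hz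
  obtain ⟨s, hs⟩ := exists_sum_tensor_dfinsupp z
  rw [← hs s subset_rfl]
  refine Finset.sum_eq_zero fun i _ => ?_
  have h : tensorLeft A (DFinsupp.lapply (R := R) (M := fun i => X i) i) z = 0 :=
    (injective_iff_map_eq_zero _).1 (hX i A A' g hg) _ (by
      rw [tensorRight_comp_tensorLeft, hz, map_zero])
  rw [h, map_zero]

end DirectSums

section Total

variable {R : Type u} [Ring R] (C : AcyclicComplex R)

/-- The differential `X i → X j`, for indices which satisfy `i = j + 1` propositionally. -/
def AcyclicComplex.dTo (i j : ℤ) (h : j + 1 = i) : C.X i →ₗ[R] C.X j := by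
  subst h
  exact C.d j

/-- The differential of the periodic complex with terms `⨁ X i`. -/
def AcyclicComplex.totalD : (Π₀ i, C.X i) →ₗ[R] (Π₀ i, C.X i) :=
  DFinsupp.lsum ℕ fun i =>
    DFinsupp.lsingle (i - 1) ∘ₗ C.dTo i (i - 1) (by lia)

lemma AcyclicComplex.totalD_single (i : ℤ) (x : C.X (i + 1)) :
    C.totalD (DFinsupp.single (i + 1) x) = DFinsupp.single i (C.d i x) := by
  have key : ∀ j (h : j + 1 = i + 1), (DFinsupp.single j (C.dTo (i + 1) j h x) : Π₀ i, C.X i) =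
      DFinsupp.single i (C.d i x) := by
    intro j h
    obtain rfl : j = i := by lia
    rfl
  rw [totalD, DFinsupp.lsum_single]
  exact key _ _

lemma AcyclicComplex.totalD_apply (i : ℤ) (v : Π₀ i, C.X i) :
    C.totalD v i = C.d i (v (i + 1)) := by
  suffices h : DFinsupp.lapply i ∘ₗ C.totalD = C.d i ∘ₗ DFinsupp.lapply (i + 1) from
    LinearMap.congr_fun h v
  refine DFinsupp.lhom_ext fun j x => ?_
  obtain ⟨k, rfl⟩ : ∃ k, j = k + 1 := ⟨j - 1, by lia⟩
  simp only [LinearMap.comp_apply, totalD_single, DFinsupp.lapply_apply]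
  by_cases h : k = i
  · subst h
    simp
  · rw [DFinsupp.single_eq_of_ne (Ne.symm h), DFinsupp.single_eq_of_ne (by lia), map_zero]

lemma AcyclicComplex.totalD_comp_totalD : C.totalD ∘ₗ C.totalD = 0 := by
  refine LinearMap.ext fun v => DFinsupp.ext fun i => ?_
  rw [LinearMap.comp_apply, totalD_apply, totalD_apply]
  exact (C.exact i).apply_apply_eq_zero _

lemma AcyclicComplex.TensorInjectiveAcyclic.totalD_exact {C : AcyclicComplex R}
    (hC : C.TensorInjectiveAcyclic) (I : ModuleCat.{u} Rᵐᵒᵖ) (hI : Module.Injective Rᵐᵒᵖ I) :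
    Function.Exact (tensorLeft I C.totalD) (tensorLeft I C.totalD) := by
  intro z
  constructor
  · intro hz
    have h : ∀ j, ∃ y, tensorLeft I (C.d j) y =
        tensorLeft I (DFinsupp.lapply (R := R) (M := fun i => C.X i) j) z := by
      intro j
      obtain ⟨k, rfl⟩ : ∃ k, j = k + 1 := ⟨j - 1, by lia⟩
      refine (hC I hI k _).1 ?_
      have hk : C.d k ∘ₗ DFinsupp.lapply (k + 1) = DFinsupp.lapply k ∘ₗ C.totalD :=
        LinearMap.ext fun v => (C.totalD_apply k v).symm
      rw [← tensorLeft_comp_apply, hk, tensorLeft_comp_apply, hz, map_zero]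
    choose y hy using h
    obtain ⟨s, hs⟩ := exists_sum_tensor_dfinsupp z
    refine ⟨∑ j ∈ s, tensorLeft I
      (DFinsupp.lsingle (R := R) (M := fun i => C.X i) (j + 1)) (y j), ?_⟩
    rw [← hs s subset_rfl, map_sum]
    refine Finset.sum_congr rfl fun j _ => ?_
    have hj : C.totalD ∘ₗ DFinsupp.lsingle (j + 1) = DFinsupp.lsingle j ∘ₗ C.d j :=
      LinearMap.ext fun x => C.totalD_single j x
    rw [← hy, ← tensorLeft_comp_apply, hj, tensorLeft_comp_apply]
  · rintro ⟨z, rfl⟩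
    rw [← tensorLeft_comp_apply, C.totalD_comp_totalD, tensorLeft_zero]
    rfl

/-- If a complex of projectives is acyclic after tensoring with injectives, then it is acyclic
after applying `Hom(_, F)` for any flat module `F`. -/
theorem AcyclicComplex.exists_comp_d_eq {C : AcyclicComplex R}
    (hP : ∀ i, Module.Projective R (C.X i)) (hC : C.TensorInjectiveAcyclic)
    {F : Type u} [AddCommGroup F] [Module R F] (hF : IsFlat R F) (i : ℤ)
    (h : C.X (i + 1) →ₗ[R] F) (hh : h ∘ₗ C.d (i + 1) = 0) :
    ∃ w : C.X i →ₗ[R] F, w ∘ₗ C.d i = h := by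
  obtain ⟨w, hw⟩ := exists_comp_eq_of_periodic C.totalD C.totalD_comp_totalD hC.totalD_exact hF
    (h ∘ₗ DFinsupp.lapply (i + 1)) <| LinearMap.ext fun v => by
      simp only [LinearMap.comp_apply, DFinsupp.lapply_apply, C.totalD_apply]
      exact LinearMap.congr_fun hh _
  refine ⟨w ∘ₗ DFinsupp.lsingle (M := fun i => C.X i) i, LinearMap.ext fun x => ?_⟩
  have := LinearMap.congr_fun hw (DFinsupp.single (i + 1) x)
  rw [LinearMap.comp_apply, C.totalD_single] at this
  simpa using this

end Total

/-! ### Projective dimension of flat modules with a finite PGF-resolution -/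

section Ext

open CategoryTheory Abelian

variable {R : Type u} [Ring R]

/-- The groups `Ext^j(M, K)` vanish for all flat modules `K` and `j > n`. -/
def FlatExtVanish (M : ModuleCat.{u} R) (n : ℕ) : Prop :=
  ∀ K : ModuleCat.{u} R, IsFlat R K → ∀ j, n < j → ∀ e : Ext.{u} M K j, e = 0

lemma FlatExtVanish.of_iso {M N : ModuleCat.{u} R} {n : ℕ} (hM : FlatExtVanish M n) (i : M ≅ N) :
    FlatExtVanish N n := by
  intro K hK j hj e
  rw [← e.mk₀_id_comp, ← i.inv_hom_id, ← Ext.mk₀_comp_mk₀, Ext.comp_assoc_of_second_deg_zero,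
    hM K hK j hj ((Ext.mk₀ i.hom).comp e (zero_add j)), Ext.comp_zero]

lemma FlatExtVanish.X₃ {S : ShortComplex (ModuleCat.{u} R)} (hS : S.ShortExact) {n : ℕ}
    (h₁ : FlatExtVanish S.X₁ n) (h₂ : FlatExtVanish S.X₂ (n + 1)) :
    FlatExtVanish S.X₃ (n + 1) := by
  intro K hK j hj e
  obtain ⟨j, rfl⟩ : ∃ k, j = 1 + k := ⟨j - 1, by lia⟩
  obtain ⟨x, rfl⟩ := Ext.contravariant_sequence_exact₃ hS K e (h₂ K hK _ hj _) rfl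
  rw [h₁ K hK j (by lia) x, Ext.comp_zero]

lemma FlatExtVanish.mono {M : ModuleCat.{u} R} {m n : ℕ} (hM : FlatExtVanish M m) (h : m ≤ n) :
    FlatExtVanish M n := fun K hK j hj => hM K hK j (h.trans_lt hj)

/-- The short exact sequence `0 → Z (i + 1) → X (i + 1) → Z i → 0` of the syzygies of an acyclic
complex. -/
abbrev AcyclicComplex.syzygyComplex (C : AcyclicComplex R) (i : ℤ) :
    ShortComplex (ModuleCat.{u} R) :=
  ModuleCat.shortComplexOfCompEqZero (LinearMap.range (C.d (i + 1))).subtype (C.d i).rangeRestrict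
    (LinearMap.ext fun ⟨_, x, hx⟩ => Subtype.ext (by
      subst hx
      exact (C.exact i).apply_apply_eq_zero x))

lemma AcyclicComplex.syzygyComplex_shortExact (C : AcyclicComplex R) (i : ℤ) :
    (C.syzygyComplex i).ShortExact := by
  refine ModuleCat.shortComplex_shortExact _ (fun x => ?_) Subtype.val_injective
    (C.d i).surjective_rangeRestrict
  have h : (C.d i).rangeRestrict x = 0 ↔ C.d i x = 0 := Subtype.ext_iff
  refine (h.trans (C.exact i x)).trans ?_
  constructor
  · rintro ⟨y, rfl⟩
    exact ⟨⟨_, y, rfl⟩, rfl⟩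
  · rintro ⟨⟨_, y, rfl⟩, rfl⟩
    exact ⟨y, rfl⟩

/-- `Ext^j(G, K) = 0` for the syzygies `G` of a PGF-complex, `K` flat and `j > 0`. -/
lemma AcyclicComplex.flatExtVanish {C : AcyclicComplex R}
    (hP : ∀ i, Module.Projective R (C.X i)) (hC : C.TensorInjectiveAcyclic) (i : ℤ) :
    FlatExtVanish (ModuleCat.of R (LinearMap.range (C.d i))) 0 := by
  intro K hK j hj e
  induction j generalizing i with
  | zero => exact absurd hj (lt_irrefl 0)
  | succ j ih =>
    have hproj : Projective (C.syzygyComplex i).X₂ :=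
      (IsProjective.iff_projective (R := R) (C.X (i + 1))).1 (hP (i + 1))
    obtain ⟨x, rfl⟩ := Ext.contravariant_sequence_exact₃ (C.syzygyComplex_shortExact i) K e
      (Ext.eq_zero_of_projective _) (add_comm 1 j)
    rcases Nat.eq_zero_or_pos j with rfl | hj'
    · -- A map from a syzygy to `K` extends to a term of the complex.
      obtain ⟨f, rfl⟩ := Ext.homEquiv₀.symm.surjective x
      obtain ⟨w, hw⟩ := C.exists_comp_d_eq hP hC hK (i + 1)
        (f.hom ∘ₗ (C.d (i + 1)).rangeRestrict) <| LinearMap.ext fun y => by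
          have : (C.d (i + 1)).rangeRestrict (C.d (i + 1 + 1) y) = 0 :=
            Subtype.ext ((C.exact (i + 1)).apply_apply_eq_zero y)
          rw [LinearMap.comp_apply, LinearMap.comp_apply, this, map_zero]
          rfl
      have hfw : f = (C.syzygyComplex i).f ≫ ModuleCat.ofHom w := by
        ext ⟨_, y, rfl⟩
        exact (LinearMap.congr_fun hw y).symm
      rw [Ext.homEquiv₀_symm_apply, hfw, ← Ext.mk₀_comp_mk₀]
      exact (C.syzygyComplex_shortExact i).extClass_comp_assoc _
    · rw [ih (i + 1) hj' x, Ext.comp_zero]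

lemma IsPGF.flatExtVanish {M : ModuleCat.{u} R} (hM : IsPGF R M) : FlatExtVanish M 0 := by
  obtain ⟨C, hP, hC, i, ⟨e⟩⟩ := hM
  exact (C.flatExtVanish hP hC i).of_iso e.symm.toModuleIso

lemma HasPGFResolution.flatExtVanish {M : ModuleCat.{u} R} {n : ℕ} (hM : HasPGFResolution R M n) :
    FlatExtVanish M n := by
  induction n generalizing M with
  | zero =>
    obtain ⟨G, ε, d, hG, hG', hε, hdε, -⟩ := hM
    have := hG' 1 one_pos
    have hinj : Function.Injective ε := by
      rw [injective_iff_map_eq_zero]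
      intro x hx
      obtain ⟨y, rfl⟩ := (hdε x).1 hx
      rw [Subsingleton.elim y 0, map_zero]
    exact (hG 0 le_rfl).flatExtVanish.of_iso (LinearEquiv.ofBijective ε ⟨hinj, hε⟩).toModuleIso
  | succ n ih =>
    obtain ⟨G, ε, d, hG, hG', hε, hdε, hd⟩ := hM
    refine FlatExtVanish.X₃ (LinearMap.shortExact_shortComplexKer hε) (ih ?_)
      ((hG 0 (Nat.zero_le _)).flatExtVanish.mono (Nat.zero_le _))
    refine ⟨fun i => G (i + 1),
      (d 0).codRestrict _ (fun x => hdε.apply_apply_eq_zero x), fun i => d (i + 1),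
      fun i hi => hG (i + 1) (by lia), fun i hi => hG' (i + 1) (by lia), ?_, ?_,
      fun i => hd (i + 1)⟩
    · rintro ⟨x, hx⟩
      obtain ⟨y, rfl⟩ := (hdε x).1 hx
      exact ⟨y, rfl⟩
    · intro x
      exact Subtype.ext_iff.trans (hd 0 x)

/-- A flat module `F` with `Ext^j(F, K) = 0` for all flat `K` and `j > n` has projective dimension
at most `n`, as the syzygies of `F` are flat. -/
lemma FlatExtVanish.hasProjectiveDimensionLE {F : ModuleCat.{u} R} (hF : IsFlat R F) {n : ℕ}
    (h : FlatExtVanish F n) : HasProjectiveDimensionLE F n := by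
  induction n generalizing F with
  | zero =>
    have hp := Finsupp.linearCombination_id_surjective R F
    have hS := LinearMap.shortExact_shortComplexKer hp
    have hK : IsFlat R (LinearMap.ker (Finsupp.linearCombination R (id : F → F))) :=
      isFlat_finsupp.of_exact hF Subtype.val_injective (LinearMap.exact_subtype_ker_map _) hp
    obtain ⟨φ, hφ⟩ := Ext.covariant_sequence_exact₃ F hS (Ext.mk₀ (𝟙 F)) (zero_add 1)
      (h (ModuleCat.of R _) hK 1 one_pos _)
    obtain ⟨φ, rfl⟩ := Ext.homEquiv₀.symm.surjective φ
    have hproj : Projective (ModuleCat.of R (F →₀ R)) :=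
      (IsProjective.iff_projective (R := R) (F →₀ R)).1 inferInstance
    have r : Retract F (ModuleCat.of R (F →₀ R)) :=
      ⟨φ, _, Ext.homEquiv₀.symm.injective (by simpa using hφ)⟩
    exact r.hasProjectiveDimensionLT 1
  | succ n ih =>
    have hp := Finsupp.linearCombination_id_surjective R F
    have hS := LinearMap.shortExact_shortComplexKer hp
    have hK : IsFlat R (LinearMap.ker (Finsupp.linearCombination R (id : F → F))) :=
      isFlat_finsupp.of_exact hF Subtype.val_injective (LinearMap.exact_subtype_ker_map _) hp
    have hproj : Projective (ModuleCat.of R (F →₀ R)) :=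
      (IsProjective.iff_projective (R := R) (F →₀ R)).1 inferInstance
    refine hS.hasProjectiveDimensionLT_X₃ _ (ih (F := ModuleCat.of R _) hK ?_)
      (hasProjectiveDimensionLT_of_ge (ModuleCat.of R (F →₀ R)) 1 _ (by lia))
    intro K hK j hj e
    obtain ⟨x, rfl⟩ := Ext.contravariant_sequence_exact₁ hS K e rfl (h K hK (1 + j) (by lia) _)
    rw [Ext.eq_zero_of_hasProjectiveDimensionLT x 1 (by lia), Ext.comp_zero]

lemma pd_le_iff (M : ModuleCat.{u} R) (n : ℕ) : pd R M ≤ n ↔ HasProjectiveDimensionLE M n := by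
  rw [← projectiveDimension_le_iff, pd]
  exact WithBot.unbotD_le_iff fun _ => bot_le

/-- The projective dimension of a flat module is at most its PGF-dimension. -/
theorem pd_le_pgfDim (F : ModuleCat.{u} R) (hF : IsFlat R F) : pd R F ≤ pgfDim R F :=
  le_iInf₂ fun n hn => (pd_le_iff F n).2 (hn.flatExtVanish.hasProjectiveDimensionLE hF)

end Ext

/-! ### PGF-resolutions of Gorenstein flat modules -/

section SplitComplex

variable {R : Type u} [Ring R] {M N : Type u} [AddCommGroup M] [Module R M]
  [AddCommGroup N] [Module R N]

lemma IsFlat.prod (hM : IsFlat R M) (hN : IsFlat R N) : IsFlat R (M × N) := by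
  intro A B _ _ _ _ g hg
  rw [injective_iff_map_eq_zero]
  intro z hz
  have h₁ : tensorLeft A (LinearMap.fst R M N) z = 0 :=
    (injective_iff_map_eq_zero _).1 (hM A B g hg) _ (by
      rw [tensorRight_comp_tensorLeft, hz, map_zero])
  have h₂ : tensorLeft A (LinearMap.snd R M N) z = 0 :=
    (injective_iff_map_eq_zero _).1 (hN A B g hg) _ (by
      rw [tensorRight_comp_tensorLeft, hz, map_zero])
  have hid : (LinearMap.id : M × N →ₗ[R] M × N) = LinearMap.inl R M N ∘ₗ LinearMap.fst R M N +
      LinearMap.inr R M N ∘ₗ LinearMap.snd R M N := LinearMap.ext fun x => by simp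
  have hz' : tensorLeft A (LinearMap.id : M × N →ₗ[R] M × N) z = z := by rw [tensorLeft_id]; rfl
  rw [← hz', hid, tensorLeft_add, AddMonoidHom.add_apply, tensorLeft_comp_apply,
    tensorLeft_comp_apply, h₁, h₂, map_zero, map_zero, add_zero]

variable (R M) in
/-- The contractible complex with terms `M × M` and differentials `(a, b) ↦ (b, 0)`. -/
def splitComplex : AcyclicComplex R where
  X _ := ModuleCat.of R (M × M)
  d _ := LinearMap.inl R M M ∘ₗ LinearMap.snd R M M
  exact _ := by
    rintro ⟨a, b⟩
    constructor
    · intro h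
      obtain rfl : b = 0 := congrArg Prod.fst h
      exact ⟨(0, a), rfl⟩
    · rintro ⟨⟨a', b'⟩, h⟩
      rw [← h]
      rfl

lemma splitComplex_tensorInjectiveAcyclic : (splitComplex R M).TensorInjectiveAcyclic := by
  intro I _ _ _ i
  let d : M × M →ₗ[R] M × M := LinearMap.inl R M M ∘ₗ LinearMap.snd R M M
  let k : M × M →ₗ[R] M × M := LinearMap.inr R M M ∘ₗ LinearMap.fst R M M
  have hid : LinearMap.id = d ∘ₗ k + k ∘ₗ d := LinearMap.ext fun x => by simp [d, k]
  have hdd : d ∘ₗ d = 0 := LinearMap.ext fun x => by simp [d]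
  suffices h : Function.Exact (tensorLeft I d) (tensorLeft I d) from h
  intro z
  constructor
  · intro hz
    have hz' : tensorLeft I (LinearMap.id : M × M →ₗ[R] M × M) z = z := by rw [tensorLeft_id]; rfl
    rw [hid, tensorLeft_add, AddMonoidHom.add_apply, tensorLeft_comp_apply d k,
      tensorLeft_comp_apply k d, hz, map_zero, add_zero] at hz'
    exact ⟨_, hz'⟩
  · rintro ⟨y, rfl⟩
    rw [← tensorLeft_comp_apply, hdd, tensorLeft_zero]
    rfl

lemma splitComplex_hasSyzygy : (splitComplex R M).HasSyzygy M := by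
  let f : M →ₗ[R] LinearMap.range ((splitComplex R M).d 0) :=
    (LinearMap.inl R M M).codRestrict _ fun x => ⟨((0, x) : M × M), rfl⟩
  refine ⟨0, ⟨LinearEquiv.ofBijective f ⟨fun x y h => ?_, ?_⟩⟩⟩
  · exact congrArg Prod.fst (congrArg Subtype.val h)
  · rintro ⟨_, y, rfl⟩
    exact ⟨y.2, rfl⟩

lemma IsFlat.isGorensteinFlat (hM : IsFlat R M) : IsGorensteinFlat R M :=
  ⟨splitComplex R M, fun _ => hM.prod hM, splitComplex_tensorInjectiveAcyclic,
    splitComplex_hasSyzygy⟩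

lemma isPGF_of_projective [Module.Projective R M] : IsPGF R M :=
  ⟨splitComplex R M, fun _ => inferInstanceAs (Module.Projective R (M × M)),
    splitComplex_tensorInjectiveAcyclic, splitComplex_hasSyzygy⟩

end SplitComplex

section Resolutions

variable {R : Type u} [Ring R] {M N L : Type u} [AddCommGroup M] [Module R M]
  [AddCommGroup N] [Module R N] [AddCommGroup L] [Module R L]

lemma IsPGF.hasPGFResolution (hM : IsPGF R M) : HasPGFResolution R M 0 := by
  refine ⟨fun i => Nat.casesOn i (ModuleCat.of R M) fun _ => ModuleCat.of R PUnit, LinearMap.id,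
    fun _ => 0, ?_, ?_, Function.surjective_id, ?_, ?_⟩
  · intro i hi
    obtain rfl : i = 0 := by lia
    exact hM
  · rintro (_ | i) hi
    · exact absurd hi (lt_irrefl 0)
    · exact inferInstanceAs (Subsingleton PUnit)
  · intro x
    exact ⟨fun h => ⟨0, (map_zero _).trans h.symm⟩, fun ⟨_, h⟩ => h.symm⟩
  · intro i x
    exact ⟨fun _ => ⟨0, Subsingleton.elim (α := PUnit) _ _⟩, fun _ => rfl⟩

lemma HasPGFResolution.of_equiv {n : ℕ} (hM : HasPGFResolution R M n) (e : M ≃ₗ[R] N) :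
    HasPGFResolution R N n := by
  obtain ⟨G, ε, d, hG, hG', hε, hdε, hd⟩ := hM
  refine ⟨G, e.toLinearMap ∘ₗ ε, d, hG, hG', e.surjective.comp hε, fun x => ?_, hd⟩
  rw [← hdε x]
  exact e.map_eq_zero_iff

/-- The sequence `N, G 0, G 1, …`. -/
def consSeq (N : ModuleCat.{u} R) (G : ℕ → ModuleCat.{u} R) : ℕ → ModuleCat.{u} R
  | 0 => N
  | i + 1 => G i

lemma HasPGFResolution.succ {n : ℕ} {f : M →ₗ[R] N} {g : N →ₗ[R] L}
    (hM : HasPGFResolution R M n) (hN : IsPGF R N) (hf : Function.Injective f)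
    (hfg : Function.Exact f g) (hg : Function.Surjective g) : HasPGFResolution R L (n + 1) := by
  obtain ⟨G, ε, d, hG, hG', hε, hdε, hd⟩ := hM
  refine ⟨consSeq (ModuleCat.of R N) G, g, fun i => Nat.casesOn i (motive := fun i =>
      consSeq (ModuleCat.of R N) G (i + 1) →ₗ[R] consSeq (ModuleCat.of R N) G i) (f ∘ₗ ε) d,
    ?_, ?_, hg, fun x => ?_, ?_⟩
  · rintro (_ | i) hi
    · exact hN
    · exact hG i (by lia)
  · rintro (_ | i) hi
    · exact absurd hi (Nat.not_lt_zero _)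
    · exact hG' i (by lia)
  · refine (hfg x).trans ⟨?_, ?_⟩
    · rintro ⟨y, rfl⟩
      obtain ⟨z, rfl⟩ := hε y
      exact ⟨z, rfl⟩
    · rintro ⟨z, rfl⟩
      exact ⟨ε z, rfl⟩
  · rintro (_ | i)
    · intro x
      exact (map_eq_zero_iff f hf).trans (hdε x)
    · exact hd i

end Resolutions

section Cover

variable {R : Type u} [Ring R] (C : AcyclicComplex R)

namespace AcyclicComplex

/-- The canonical free module mapping onto the `i`-th term. -/
abbrev Q (i : ℤ) : Type u := C.X i →₀ R

/-- The canonical surjection from a free module to the `i`-th term. -/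
abbrev p (i : ℤ) : C.Q i →ₗ[R] C.X i := Finsupp.linearCombination R id

lemma p_surjective (i : ℤ) : Function.Surjective (C.p i) :=
  Finsupp.linearCombination_id_surjective R _

/-- The terms of the contractible complex of free modules that maps onto the complex. -/
abbrev P (i : ℤ) : Type u := C.Q (i + 1) × C.Q i

/-- The differential of the complex with terms `P`. -/
def dP (i : ℤ) : C.P (i + 1) →ₗ[R] C.P i :=
  LinearMap.inl R (C.Q (i + 1)) (C.Q i) ∘ₗ LinearMap.snd R (C.Q (i + 1 + 1)) (C.Q (i + 1))

/-- The contraction of the complex with terms `P`. -/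
def kP (i : ℤ) : C.P i →ₗ[R] C.P (i + 1) :=
  LinearMap.inr R (C.Q (i + 1 + 1)) (C.Q (i + 1)) ∘ₗ LinearMap.fst R (C.Q (i + 1)) (C.Q i)

/-- The surjection from the complex with terms `P`. -/
def ε (i : ℤ) : C.P i →ₗ[R] C.X i := (C.d i ∘ₗ C.p (i + 1)).coprod (C.p i)

lemma dP_apply (i : ℤ) (x : C.P (i + 1)) : C.dP i x = (x.2, 0) := rfl

lemma ε_apply (i : ℤ) (x : C.P i) : C.ε i x = C.d i (C.p (i + 1) x.1) + C.p i x.2 := rfl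

lemma ε_surjective (i : ℤ) : Function.Surjective (C.ε i) := fun y => by
  obtain ⟨x, rfl⟩ := C.p_surjective i y
  exact ⟨(0, x), by rw [ε_apply, map_zero, map_zero, zero_add]⟩

lemma ε_comp_dP (i : ℤ) : C.ε i ∘ₗ C.dP i = C.d i ∘ₗ C.ε (i + 1) := by
  refine LinearMap.ext fun x => ?_
  rw [LinearMap.comp_apply, LinearMap.comp_apply, ε_apply, ε_apply, dP_apply, map_add,
    (C.exact i).apply_apply_eq_zero, zero_add, map_zero, add_zero]

lemma dP_comp_dP (i : ℤ) : C.dP i ∘ₗ C.dP (i + 1) = 0 := rfl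

lemma kP_homotopy (i : ℤ) :
    LinearMap.id = C.dP (i + 1) ∘ₗ C.kP (i + 1) + C.kP i ∘ₗ C.dP i :=
  LinearMap.ext fun x => by simp [dP, kP]

lemma dP_mem_ker (i : ℤ) (x : C.P (i + 1)) (hx : x ∈ LinearMap.ker (C.ε (i + 1))) :
    C.dP i x ∈ LinearMap.ker (C.ε i) := by
  have h := LinearMap.congr_fun (C.ε_comp_dP i) x
  rw [LinearMap.comp_apply, LinearMap.comp_apply, LinearMap.mem_ker.1 hx, map_zero] at h
  exact h

/-- The kernel of the surjection from a contractible complex of free modules. -/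
def coverKer : AcyclicComplex R where
  X i := ModuleCat.of R (LinearMap.ker (C.ε i))
  d i := (C.dP i).restrict (C.dP_mem_ker i)
  exact i := by
    rintro ⟨⟨a, b⟩, hx⟩
    constructor
    · intro h
      obtain rfl : b = 0 := congrArg Prod.fst (congrArg Subtype.val h)
      have ha : C.d (i + 1) (C.p (i + 1 + 1) a) = 0 := by
        have := LinearMap.mem_ker.1 hx
        rwa [ε_apply, map_zero, add_zero] at this
      obtain ⟨y, hy⟩ := (C.exact (i + 1) _).1 ha
      obtain ⟨q, hq⟩ := C.p_surjective _ (-y)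
      refine ⟨⟨(q, a), ?_⟩, rfl⟩
      rw [LinearMap.mem_ker, ε_apply]
      dsimp only
      rw [hq, map_neg, hy, neg_add_cancel]
    · rintro ⟨x, h⟩
      rw [← h]
      rfl

/-- The inclusion of `coverKer` into the complex with terms `P`. -/
def ι (i : ℤ) : C.coverKer.X i →ₗ[R] C.P i := (LinearMap.ker (C.ε i)).subtype

lemma ι_injective (i : ℤ) : Function.Injective (C.ι i) := Subtype.val_injective

lemma ι_exact (i : ℤ) : Function.Exact (C.ι i) (C.ε i) := LinearMap.exact_subtype_ker_map (C.ε i)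

lemma ι_comp_d (i : ℤ) : C.ι i ∘ₗ C.coverKer.d i = C.dP i ∘ₗ C.ι (i + 1) := rfl

/-- The syzygies of a complex and those of `coverKer` are linked by short exact sequences whose
middle terms are free. -/
lemma exists_exact_coverKer (i : ℤ) :
    ∃ (f : LinearMap.range (C.coverKer.d i) →ₗ[R] C.Q (i + 1))
      (g : C.Q (i + 1) →ₗ[R] LinearMap.range (C.d i)),
      Function.Injective f ∧ Function.Exact f g ∧ Function.Surjective g := by
  refine ⟨LinearMap.fst R _ _ ∘ₗ (LinearMap.ker (C.ε i)).subtype ∘ₗ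
    (LinearMap.range (C.coverKer.d i)).subtype, (C.d i).rangeRestrict ∘ₗ C.p (i + 1), ?_, ?_,
    (C.d i).surjective_rangeRestrict.comp (C.p_surjective _)⟩
  · rintro ⟨_, x, rfl⟩ ⟨_, y, rfl⟩ h
    exact Subtype.ext (Subtype.ext (Prod.ext h rfl))
  · intro b
    refine Subtype.ext_iff.trans ⟨fun hb => ?_, ?_⟩
    · obtain ⟨y, hy⟩ := (C.exact i _).1 hb
      obtain ⟨q, hq⟩ := C.p_surjective _ (-y)
      have hmem : ((q, b) : C.P (i + 1)) ∈ LinearMap.ker (C.ε (i + 1)) := by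
        rw [LinearMap.mem_ker, ε_apply]
        dsimp only
        rw [hq, map_neg, hy, neg_add_cancel]
      exact ⟨⟨C.coverKer.d i ⟨_, hmem⟩, ⟨_, hmem⟩, rfl⟩, rfl⟩
    · rintro ⟨⟨_, ⟨⟨a, b⟩, hx⟩, rfl⟩, rfl⟩
      have h := congrArg (C.d i) (LinearMap.mem_ker.1 hx)
      rw [ε_apply, map_add, (C.exact i).apply_apply_eq_zero, zero_add, map_zero] at h
      exact h

variable {C}

lemma isFlat_coverKer (hC : ∀ i, IsFlat R (C.X i)) (i : ℤ) : IsFlat R (C.coverKer.X i) :=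
  (isFlat_of_projective (C.P i)).of_exact (hC i) (C.ι_injective i) (C.ι_exact i)
    (C.ε_surjective i)

/-- The sequence `0 → coverKer C → P → C → 0` is pure, as `C` consists of flat modules, so that
`coverKer C` inherits acyclicity under `I ⊗_R _` from `C` and the contractible complex `P`. -/
lemma TensorInjectiveAcyclic.coverKer (hC : C.TensorInjectiveAcyclic)
    (hflat : ∀ i, IsFlat R (C.X i)) : C.coverKer.TensorInjectiveAcyclic := by
  intro I _ _ hI i z
  have hε : ∀ j, Function.Exact (tensorLeft I (C.ι j)) (tensorLeft I (C.ε j)) := fun j =>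
    tensorLeft_exact (C.ι_exact j) (C.ε_surjective j)
  have hι : ∀ j, Function.Injective (tensorLeft I (C.ι j)) := fun j =>
    (hflat j).tensorLeft_injective (C.ι_injective j) (C.ι_exact j) (C.ε_surjective j)
  have hιd : ∀ j y, tensorLeft I (C.ι j) (tensorLeft I (C.coverKer.d j) y) =
      tensorLeft I (C.dP j) (tensorLeft I (C.ι (j + 1)) y) := fun j y => by
    rw [← tensorLeft_comp_apply, ← tensorLeft_comp_apply, ι_comp_d]
  have hdd : ∀ j y, tensorLeft I (C.dP j) (tensorLeft I (C.dP (j + 1)) y) = 0 := fun j y => by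
    rw [← tensorLeft_comp_apply, dP_comp_dP, tensorLeft_zero]
    rfl
  have hεd : ∀ j y, tensorLeft I (C.ε j) (tensorLeft I (C.dP j) y) =
      tensorLeft I (C.d j) (tensorLeft I (C.ε (j + 1)) y) := fun j y => by
    rw [← tensorLeft_comp_apply, ← tensorLeft_comp_apply, ε_comp_dP]
  constructor
  · intro hz
    let z' := tensorLeft I (C.ι (i + 1)) z
    have hz' : tensorLeft I (C.dP i) z' = 0 := by rw [← hιd, hz, map_zero]
    have hu : tensorLeft I (C.dP (i + 1)) (tensorLeft I (C.kP (i + 1)) z') = z' := by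
      have h : tensorLeft I (LinearMap.id : C.P (i + 1) →ₗ[R] C.P (i + 1)) z' = z' := by
        rw [tensorLeft_id]; rfl
      rwa [kP_homotopy, tensorLeft_add, AddMonoidHom.add_apply, tensorLeft_comp_apply,
        tensorLeft_comp_apply, hz', map_zero, add_zero] at h
    obtain ⟨v, hv⟩ := (hC I hI (i + 1) (tensorLeft I (C.ε (i + 1 + 1))
      (tensorLeft I (C.kP (i + 1)) z'))).1 (by
        rw [← hεd, hu]
        exact (hε (i + 1)).apply_apply_eq_zero z)
    obtain ⟨v, rfl⟩ := tensorLeft_surjective (A := I) _ (C.ε_surjective _) v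
    obtain ⟨y, hy⟩ := (hε (i + 1 + 1) (tensorLeft I (C.kP (i + 1)) z' -
      tensorLeft I (C.dP (i + 1 + 1)) v)).1 (by rw [map_sub, hεd, hv, sub_self])
    refine ⟨y, hι (i + 1) ?_⟩
    rw [hιd, hy, map_sub, hu, hdd, sub_zero]
  · rintro ⟨y, rfl⟩
    apply hι i
    rw [hιd, hιd, hdd, map_zero]

open CategoryTheory in
/-- The syzygies of a complex of flat modules of projective dimension at most `n`, acyclic under
`I ⊗_R _` for `I` injective, have PGF-resolutions of length `n`: the `n`-fold iteration of
`coverKer` consists of projective modules. -/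
lemma hasPGFResolution_range {n : ℕ} (hC : C.TensorInjectiveAcyclic)
    (hflat : ∀ i, IsFlat R (C.X i)) (hpd : ∀ i, HasProjectiveDimensionLE (C.X i) n) (i : ℤ) :
    HasPGFResolution R (LinearMap.range (C.d i)) n := by
  induction n generalizing C with
  | zero =>
    refine IsPGF.hasPGFResolution ⟨C, fun j => ?_, hC, i, ⟨LinearEquiv.refl R _⟩⟩
    exact (IsProjective.iff_projective (R := R) (C.X j)).2
      ((projective_iff_hasProjectiveDimensionLE_zero _).2 (hpd j))
  | succ n ih =>
    obtain ⟨f, g, hf, hfg, hg⟩ := C.exists_exact_coverKer i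
    refine HasPGFResolution.succ (ih (hC.coverKer hflat) (isFlat_coverKer hflat) fun j => ?_)
      isPGF_of_projective hf hfg hg
    have hproj : Projective (ModuleCat.of R (C.P j)) :=
      (IsProjective.iff_projective (R := R) (C.P j)).1 inferInstance
    exact (LinearMap.shortExact_shortComplexKer (C.ε_surjective j)).hasProjectiveDimensionLT_X₁
      (n + 1) (hasProjectiveDimensionLT_of_ge (ModuleCat.of R (C.P j)) 1 _ (by lia)) (hpd j)

end AcyclicComplex

lemma pd_le_splf (M : ModuleCat.{u} R) (hM : IsFlat R M) : pd R M ≤ splf R :=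
  le_sSup ⟨M, hM, rfl⟩

/-- The PGF-dimension of a Gorenstein flat module is at most `splf R`. -/
theorem IsGorensteinFlat.pgfDim_le_splf {M : ModuleCat.{u} R} (hM : IsGorensteinFlat R M) :
    pgfDim R M ≤ splf R := by
  obtain ⟨C, hflat, hC, i, ⟨e⟩⟩ := hM
  induction hn : splf R using ENat.recTopCoe with
  | top => exact le_top
  | coe n =>
    have hres := AcyclicComplex.hasPGFResolution_range (n := n) hC hflat
      (fun j => (pd_le_iff _ n).1 ((pd_le_splf _ (hflat j)).trans_eq hn)) i
    exact iInf₂_le n (hres.of_equiv e.symm)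

open CategoryTheory in
/-- If all flat modules have finite projective dimension, then there is a bound on these
dimensions, as one sees from the direct sum of a sequence of flat modules. -/
lemma splf_lt_top (h : ∀ M : ModuleCat.{u} R, IsFlat R M → pd R M < ⊤) : splf R < ⊤ := by
  rw [lt_top_iff_ne_top]
  intro htop
  have hlarge : ∀ n : ℕ, ∃ F : ModuleCat.{u} R, IsFlat R F ∧ (n : ℕ∞) < pd R F := fun n => by
    obtain ⟨_, ⟨F, hF, rfl⟩, hn⟩ := sSup_eq_top.1 htop n (ENat.natCast_lt_top n)
    exact ⟨F, hF, hn⟩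
  choose F hF hn using hlarge
  let S : ModuleCat.{u} R := ModuleCat.of R (Π₀ n, F n)
  obtain ⟨N, hN⟩ := ENat.ne_top_iff_exists.1 (h S (isFlat_dfinsupp hF)).ne
  have hS : HasProjectiveDimensionLE S N := (pd_le_iff S N).1 hN.ge
  have r : Retract (F N) S :=
    ⟨ModuleCat.ofHom (DFinsupp.lsingle (M := fun n => F n) N),
      ModuleCat.ofHom (DFinsupp.lapply (M := fun n => F n) N), by
        ext x
        exact DFinsupp.single_eq_same⟩
  exact (hn N).not_ge ((pd_le_iff _ N).2 (r.hasProjectiveDimensionLT (N + 1)))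

end Cover

end

end PGF

theorem proposition3p9 (R : Type u) [Ring R] :
    sSup {d : ℕ∞ | ∃ M : ModuleCat.{u} R, PGF.IsGorensteinFlat R M ∧ PGF.pgfDim R M = d} = PGF.splf R ∧
    ((∀ M : ModuleCat.{u} R, PGF.IsFlat R M → PGF.pd R M < ⊤) ↔
      (∀ M : ModuleCat.{u} R, PGF.IsGorensteinFlat R M → PGF.pgfDim R M < ⊤)) := by
  refine ⟨le_antisymm (sSup_le ?_) (sSup_le ?_), fun h M hM => ?_, fun h M hM => ?_⟩
  · rintro _ ⟨M, hM, rfl⟩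
    exact hM.pgfDim_le_splf
  · rintro _ ⟨M, hM, rfl⟩
    exact (PGF.pd_le_pgfDim M hM).trans (le_sSup ⟨M, hM.isGorensteinFlat, rfl⟩)
  · exact hM.pgfDim_le_splf.trans_lt (PGF.splf_lt_top h)
  · exact (PGF.pd_le_pgfDim M hM).trans_lt (h M hM.isGorensteinFlat)
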